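/- Let $E$ be a finite-dimensional Euclidean space (for instance $E=\mathbb R$) and let $\nu$ be a Lévy measure on $E$, that is, a positive Borel measure with $\nu(\{0\})=0$ and $\int \min(1,|z|^2)\,d\nu(z)<\infty$. Let $(L_t)_{t\ge 0}$ be the associated pure-jump Lévy semigroup: $L_tf(x)=\int f(x+y)\,d\mu_t(y)$, where $(\mu_t)_{t\ge0}$ is a weakly continuous convolution semigroup of probability measures on $E$ with $\mu_0=\delta_0$, and where the infinitesimal generator of $(L_t)$ is $$\mathcal I(f)(x)=\int\Big(f(x+z)-f(x)-\frac{\nabla f(x)\cdot z}{1+|z|^2}\Big)\,d\nu(z),$$ i.e. $\lim_{t\to0^+}\big(L_tf(x)-f(x)\big)/t=\mathcal I(f)(x)$ for every $f\in C_c^\infty(E)$ and $x\in E$. (i) For all $0<s\le t$ and $0<q_2\le q_1<1$ such that $q_2-1=\frac{q_2}{q_1}\,\frac ts\,(q_1-1)$, every Borel function $f:E\to[0,\infty]$ satisfies, at every point of $E$, $$\big(L_t(f^{q_1})\big)^{1/q_1}\le \big(L_s\big((L_{t-s}f)^{q_2}\big)\big)^{1/q_2}.$$ (ii) If moreover $C:=\nu(E)<\infty$,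 then for all $0<s\le t$ and $0<q_2\le q_1<1$ such that $q_2-1=\frac ts\,(q_1-1)$, every Borel function $f:E\to[0,\infty]$ satisfies, at every point of $E$, $$\big(L_t(f^{q_1})\big)^{1/q_1}\le \big(L_s\big((L_{t-s}f)^{q_2}\big)\big)^{1/q_2}\,\exp\Big[C\,\frac{s(t-s)(1-q_2)^2}{q_2(sq_2+t-s)}\Big].$$ Both sides are allowed to take the value $+\infty$. -/

import Mathlib

open MeasureTheory Filter Topology Set
open scoped ENNReal ContDiff

/-- `ν` is a Lévy measure: `ν({0}) = 0` and `∫ min(1, |z|²) dν(z) < ∞`. -/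
structure IsLevyMeasure {E : Type*} [NormedAddCommGroup E] [MeasurableSpace E]
    (ν : Measure E) : Prop where
  zero_singleton : ν {0} = 0
  lintegral_lt_top : ∫⁻ z, ENNReal.ofReal (min 1 (‖z‖ ^ 2)) ∂ν < ⊤

/-- The pure-jump Lévy operator
`I(f)(x) = ∫ (f(x+z) - f(x) - ∇f(x)·z h(z)) dν(z)` with `h(z) = 1/(1+|z|²)`.
The integrand is `ν`-integrable for all smooth compactly supported `f` when `ν` is a
Lévy measure. -/
noncomputable def levyOperator {E : Type*} [NormedAddCommGroup E] [NormedSpace ℝ E]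
    [MeasurableSpace E] (ν : Measure E) (f : E → ℝ) (x : E) : ℝ :=
  ∫ z, (f (x + z) - f x - fderiv ℝ f x z * (1 / (1 + ‖z‖ ^ 2))) ∂ν

/-- `(μ t)`, `t ≥ 0`, is the family of one-dimensional laws of a Lévy process started at `0`:
a convolution semigroup of probability measures which is weakly continuous at `t = 0`.
Only the values at `t ≥ 0` are relevant. -/
structure IsConvolutionSemigroup {E : Type*} [NormedAddCommGroup E] [MeasurableSpace E]
    (μ : ℝ → Measure E) : Prop where
  isProbabilityMeasure : ∀ t, 0 ≤ t → IsProbabilityMeasure (μ t)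
  zero : μ 0 = Measure.dirac 0
  add : ∀ s t, 0 ≤ s → 0 ≤ t → μ (s + t) = (μ s).conv (μ t)
  tendsto_zero : ∀ f : E → ℝ, Continuous f → (∃ M : ℝ, ∀ y, |f y| ≤ M) →
    Tendsto (fun t => ∫ y, f y ∂(μ t)) (𝓝[>] 0) (𝓝 (f 0))

/-- The pure-jump Lévy semigroup associated with `ν`, given by the laws `(μ t)`: the Markov
semigroup `L_t f(x) = ∫ f(x+y) dμ_t(y)` has infinitesimal generator `levyOperator ν`
on smooth compactly supported functions. -/
structure IsPureJumpLevySemigroup {E : Type*} [NormedAddCommGroup E] [NormedSpace ℝ E]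
    [MeasurableSpace E] (ν : Measure E) (μ : ℝ → Measure E) : Prop
    extends IsConvolutionSemigroup μ where
  generator : ∀ f : E → ℝ, ContDiff ℝ ∞ f → HasCompactSupport f → ∀ x : E,
    Tendsto (fun t : ℝ => ((∫ y, f (x + y) ∂(μ t)) - f x) / t) (𝓝[>] 0)
      (𝓝 (levyOperator ν f x))

/-- The action `L_t f(x) = ∫ f(x+y) dμ_t(y)` of the semigroup on nonnegative (possibly
unbounded) functions, with values in `[0, ∞]`. -/
noncomputable def levyAct {E : Type*} [NormedAddCommGroup E] [MeasurableSpace E]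
    (μ : ℝ → Measure E) (t : ℝ) (f : E → ℝ≥0∞) (x : E) : ℝ≥0∞ :=
  ∫⁻ y, f (x + y) ∂(μ t)

/-!
Put `h = (L_{t-s} f) ^ (q₂ - 1)`. With `X` the Lévy process and `β = q₂ / (1 - q₂)`, the claim
amounts to the reverse Hölder inequality
`‖f(X_t)‖_{q₁} ‖h(X_s)‖_{-β} ≤ K E[f(X_t) h(X_s)]` for the law of the pair `(X_t, X_s)`.
By conditioning, such inequalities are stable under convolution, the constants being multiplied.
The pair `(X_t, X_s)` is the limit in law of sums of `n` independent copies of `(Y, B Y)`, where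
`Y` has law `μ_{t/n}` and `B` is an independent Bernoulli variable of parameter `s / t`. So it
suffices to treat a single pair `(Y, B Y)`, for which the conditional expectation of `h(B Y)` given
`Y = y` is `(s / t) h(y) + (1 - s / t) h(0)`. In (i), the weighted AM-GM inequality gives the
constant `1`. In (ii), a translation of the process, which does not affect the inequality, makes
`μ_δ` compound Poisson, hence with mass at most `δ C` outside `0`; the one-step constant is then
`exp (δ C (r / β - 1 / α) + O(δ²))` with `r = s / t`, `α = q₁ / (1 - q₁)` and `δ = t / n`.
-/

/-- A measurable real function with values in a compact subinterval of `(0, ∞)`: all its real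
powers are integrable against every finite measure, so no integrability side conditions arise. -/
structure BddPos {α : Type*} [MeasurableSpace α] (f : α → ℝ) : Prop where
  measurable : Measurable f
  exists_bounds : ∃ c C : ℝ, 0 < c ∧ ∀ x, f x ∈ Icc c C

namespace BddPos

variable {α β : Type*} [MeasurableSpace α] [MeasurableSpace β] {f g : α → ℝ}

lemma pos (hf : BddPos f) (x : α) : 0 < f x := by
  obtain ⟨c, C, hc, h⟩ := hf.exists_bounds
  exact hc.trans_le (h x).1

lemma exists_norm_le (hf : BddPos f) : ∃ C : ℝ, ∀ x, ‖f x‖ ≤ C := by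
  obtain ⟨c, C, _, h⟩ := hf.exists_bounds
  exact ⟨C, fun x => (Real.norm_of_nonneg (hf.pos x).le).trans_le (h x).2⟩

lemma const {c : ℝ} (hc : 0 < c) : BddPos (fun _ : α => c) :=
  ⟨measurable_const, c, c, hc, fun _ => ⟨le_rfl, le_rfl⟩⟩

lemma comp (hf : BddPos f) {φ : β → α} (hφ : Measurable φ) : BddPos (fun x => f (φ x)) := by
  obtain ⟨c, C, hc, h⟩ := hf.exists_bounds
  exact ⟨hf.measurable.comp hφ, c, C, hc, fun x => h _⟩

lemma rpow (hf : BddPos f) (a : ℝ) : BddPos (fun x => f x ^ a) := by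
  obtain ⟨c, C, hc, h⟩ := hf.exists_bounds
  refine ⟨hf.measurable.pow_const a, ?_⟩
  rcases isEmpty_or_nonempty α with _ | ⟨⟨x₀⟩⟩
  · exact ⟨1, 1, one_pos, isEmptyElim⟩
  have hC : 0 < C := hc.trans_le ((h x₀).1.trans (h x₀).2)
  rcases le_total 0 a with ha | ha
  · exact ⟨c ^ a, C ^ a, Real.rpow_pos_of_pos hc a, fun x =>
      ⟨Real.rpow_le_rpow hc.le (h x).1 ha, Real.rpow_le_rpow (hf.pos x).le (h x).2 ha⟩⟩
  · exact ⟨C ^ a, c ^ a, Real.rpow_pos_of_pos hC a, fun x =>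
      ⟨Real.rpow_le_rpow_of_nonpos (hf.pos x) (h x).2 ha,
        Real.rpow_le_rpow_of_nonpos hc (h x).1 ha⟩⟩

lemma mul (hf : BddPos f) (hg : BddPos g) : BddPos (fun x => f x * g x) := by
  obtain ⟨c, C, hc, h⟩ := hf.exists_bounds
  obtain ⟨c', C', hc', h'⟩ := hg.exists_bounds
  refine ⟨hf.measurable.mul hg.measurable, c * c', C * C', mul_pos hc hc', fun x => ⟨?_, ?_⟩⟩
  · exact mul_le_mul (h x).1 (h' x).1 hc'.le (hf.pos x).le
  · exact mul_le_mul (h x).2 (h' x).2 (hg.pos x).le ((hf.pos x).le.trans (h x).2)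

lemma add (hf : BddPos f) (hg : BddPos g) : BddPos (fun x => f x + g x) := by
  obtain ⟨c, C, hc, h⟩ := hf.exists_bounds
  obtain ⟨c', C', hc', h'⟩ := hg.exists_bounds
  exact ⟨hf.measurable.add hg.measurable, c + c', C + C', add_pos hc hc', fun x =>
    ⟨add_le_add (h x).1 (h' x).1, add_le_add (h x).2 (h' x).2⟩⟩

lemma memLp (hf : BddPos f) (p : ℝ≥0∞) (μ : Measure α) [IsFiniteMeasure μ] : MemLp f p μ := by
  obtain ⟨C, hC⟩ := hf.exists_norm_le
  exact MemLp.of_bound hf.measurable.aestronglyMeasurable C (Eventually.of_forall hC)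

lemma integrable (hf : BddPos f) (μ : Measure α) [IsFiniteMeasure μ] : Integrable f μ :=
  memLp_one_iff_integrable.1 (hf.memLp 1 μ)

lemma integral_mem_Icc {μ : Measure α} [IsProbabilityMeasure μ] {c C : ℝ} (hf : BddPos f)
    (h : ∀ x, f x ∈ Icc c C) : ∫ x, f x ∂μ ∈ Icc c C := by
  constructor
  · simpa using integral_mono (μ := μ) (integrable_const c) (hf.integrable μ) fun x => (h x).1
  · simpa using integral_mono (μ := μ) (hf.integrable μ) (integrable_const C) fun x => (h x).2

lemma integral_pos (hf : BddPos f) (μ : Measure α) [IsProbabilityMeasure μ] :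
    0 < ∫ x, f x ∂μ := by
  obtain ⟨c, C, hc, h⟩ := hf.exists_bounds
  exact hc.trans_le (hf.integral_mem_Icc h).1

lemma integral_prod_right {F : α × β → ℝ} (hF : BddPos F) (μ : Measure β)
    [IsProbabilityMeasure μ] : BddPos (fun x => ∫ y, F (x, y) ∂μ) := by
  obtain ⟨c, C, hc, h⟩ := hF.exists_bounds
  exact ⟨(hF.measurable.stronglyMeasurable.integral_prod_right' (ν := μ)).measurable, c, C, hc,
    fun x => (hF.comp measurable_prodMk_left).integral_mem_Icc fun y => h _⟩

end BddPos

instance {M N : Type*} [Add M] [Add N] [MeasurableSpace M] [MeasurableSpace N] [MeasurableAdd₂ M]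
    [MeasurableAdd₂ N] : MeasurableAdd₂ (M × N) where
  measurable_add := by
    change Measurable fun p : (M × N) × (M × N) => (p.1.1 + p.2.1, p.1.2 + p.2.2)
    fun_prop

/-- The `n`-fold convolution power of a measure. -/
noncomputable def convPow {M : Type*} [AddMonoid M] [MeasurableSpace M] (κ : Measure M) :
    ℕ → Measure M
  | 0 => Measure.dirac 0
  | n + 1 => (convPow κ n).conv κ

instance {M : Type*} [AddMonoid M] [MeasurableSpace M] (κ : Measure M) [IsFiniteMeasure κ]
    (n : ℕ) : IsFiniteMeasure (convPow κ n) := by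
  induction n with
  | zero => rw [convPow]; infer_instance
  | succ n ih => rw [convPow]; infer_instance

instance {M : Type*} [AddMonoid M] [MeasurableSpace M] [MeasurableAdd₂ M] (κ : Measure M)
    [IsProbabilityMeasure κ] (n : ℕ) : IsProbabilityMeasure (convPow κ n) := by
  induction n with
  | zero => rw [convPow]; infer_instance
  | succ n ih => rw [convPow]; infer_instance

/-- The Hölder inequality with constant `K` between the two marginals of `κ`, in the reverse
direction: it is used with exponents `0 < p < 1` and `q < 0`. -/
def ReverseHolder {α β : Type*} [MeasurableSpace α] [MeasurableSpace β] (κ : Measure (α × β))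
    (p q K : ℝ) : Prop :=
  ∀ (f : α → ℝ) (h : β → ℝ), BddPos f → BddPos h →
    (∫ z, f z.1 ^ p ∂κ) ^ p⁻¹ * (∫ z, h z.2 ^ q ∂κ) ^ q⁻¹ ≤ K * ∫ z, f z.1 * h z.2 ∂κ

namespace ReverseHolder

section

variable {α β : Type*} [MeasurableSpace α] [MeasurableSpace β] {p q K : ℝ}

lemma dirac (hp : p ≠ 0) (hq : q ≠ 0) (z : α × β) :
    ReverseHolder (Measure.dirac z) p q 1 := by
  intro f h hf hh
  have hf' := (hf.rpow p).comp (φ := Prod.fst (β := β)) measurable_fst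
  have hh' := (hh.rpow q).comp (φ := Prod.snd (α := α)) measurable_snd
  have hfh := (hf.comp (φ := Prod.fst (β := β)) measurable_fst).mul (hh.comp measurable_snd)
  rw [integral_dirac' _ _ hf'.measurable.stronglyMeasurable,
    integral_dirac' _ _ hh'.measurable.stronglyMeasurable,
    integral_dirac' _ _ hfh.measurable.stronglyMeasurable,
    Real.rpow_rpow_inv (hf.pos _).le hp, Real.rpow_rpow_inv (hh.pos _).le hq, one_mul]

lemma of_normalized {κ : Measure (α × β)} (hq : q ≠ 0) (x₀ : β)
    (H : ∀ (f : α → ℝ) (h : β → ℝ), BddPos f → BddPos h → h x₀ = 1 →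
      (∫ z, f z.1 ^ p ∂κ) ^ p⁻¹ * (∫ z, h z.2 ^ q ∂κ) ^ q⁻¹ ≤ K * ∫ z, f z.1 * h z.2 ∂κ) :
    ReverseHolder κ p q K := by
  intro f h hf hh
  set c := (h x₀)⁻¹
  have hc : 0 < c := inv_pos.2 (hh.pos x₀)
  have hI : 0 ≤ ∫ z, h z.2 ^ q ∂κ := integral_nonneg fun z => ((hh.rpow q).pos _).le
  have key := H f (fun x => c * h x) hf ((BddPos.const hc).mul hh)
    (inv_mul_cancel₀ (hh.pos x₀).ne')
  have hpow : ∀ x, (c * h x) ^ q = c ^ q * h x ^ q := fun x =>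
    Real.mul_rpow hc.le (hh.pos _).le
  simp only [hpow, mul_left_comm _ c, integral_const_mul] at key
  rw [Real.mul_rpow (by positivity) hI, Real.rpow_rpow_inv hc.le hq, mul_left_comm] at key
  exact le_of_mul_le_mul_left key hc

end

variable {M N : Type*} [MeasurableSpace M] [AddMonoid M] [MeasurableAdd₂ M] [MeasurableSpace N]
  [AddMonoid N] [MeasurableAdd₂ N] {p q K K₁ K₂ : ℝ}

lemma conv {κ₁ κ₂ : Measure (M × N)} [IsProbabilityMeasure κ₁] [IsProbabilityMeasure κ₂]
    (hp : p ≠ 0) (hq : q ≠ 0) (hK : 0 ≤ K₁)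
    (h₁ : ReverseHolder κ₁ p q K₁) (h₂ : ReverseHolder κ₂ p q K₂) :
    ReverseHolder (κ₁.conv κ₂) p q (K₁ * K₂) := by
  intro f h hf hh
  have integral_eq : ∀ {g : M × N → ℝ}, BddPos g →
      ∫ z, g z ∂(κ₁.conv κ₂) = ∫ x, ∫ y, g (x + y) ∂κ₂ ∂κ₁ := fun hg =>
    integral_conv (hg.integrable _)
  have hF : BddPos (fun x : M => ∫ y, f (x + y.1) ^ p ∂κ₂) :=
    ((hf.rpow p).comp (φ := fun z : M × (M × N) => z.1 + z.2.1)
      (by fun_prop)).integral_prod_right κ₂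
  have hH : BddPos (fun x : N => ∫ y, h (x + y.2) ^ q ∂κ₂) :=
    ((hh.rpow q).comp (φ := fun z : N × (M × N) => z.1 + z.2.2)
      (by fun_prop)).integral_prod_right κ₂
  have hfh : BddPos (fun z : M × N => f z.1 * h z.2) :=
    (hf.comp measurable_fst).mul (hh.comp measurable_snd)
  have hfh' : BddPos (fun x : M × N => ∫ y, f (x.1 + y.1) * h (x.2 + y.2) ∂κ₂) :=
    (hfh.comp (φ := fun z : (M × N) × (M × N) => z.1 + z.2)
      (by fun_prop)).integral_prod_right κ₂
  rw [integral_eq ((hf.rpow p).comp measurable_fst),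
    integral_eq ((hh.rpow q).comp measurable_snd), integral_eq hfh]
  simp only [Prod.fst_add, Prod.snd_add]
  have outer := h₁ _ _ (hF.rpow p⁻¹) (hH.rpow q⁻¹)
  simp only [Real.rpow_inv_rpow (hF.pos _).le hp, Real.rpow_inv_rpow (hH.pos _).le hq] at outer
  refine outer.trans ?_
  rw [mul_assoc, ← integral_const_mul K₂]
  refine mul_le_mul_of_nonneg_left (integral_mono (BddPos.integrable ?_ κ₁)
    ((hfh'.integrable κ₁).const_mul K₂) fun x => ?_) hK
  · exact ((hF.rpow p⁻¹).comp measurable_fst).mul ((hH.rpow q⁻¹).comp measurable_snd)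
  · exact h₂ _ _ (hf.comp (φ := fun y => x.1 + y) (by fun_prop))
      (hh.comp (φ := fun y => x.2 + y) (by fun_prop))

lemma convPow {κ : Measure (M × N)} [IsProbabilityMeasure κ] (hp : p ≠ 0) (hq : q ≠ 0)
    (hK : 0 ≤ K) (h : ReverseHolder κ p q K) (n : ℕ) :
    ReverseHolder (convPow κ n) p q (K ^ n) := by
  induction n with
  | zero => simpa only [_root_.convPow, pow_zero] using dirac hp hq (0 : M × N)
  | succ n ih => exact pow_succ K n ▸ ih.conv hp hq (pow_nonneg hK n) h

end ReverseHolder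

lemma reverse_holder {Ω : Type*} [MeasurableSpace Ω] (μ : Measure Ω) [IsProbabilityMeasure μ]
    {α p : ℝ} (hα : 0 < α) (hp : p⁻¹ = 1 + α⁻¹) {f g : Ω → ℝ} (hf : BddPos f) (hg : BddPos g) :
    (∫ x, f x ^ p ∂μ) ^ p⁻¹ * (∫ x, g x ^ (-α) ∂μ) ^ (-α)⁻¹ ≤ ∫ x, f x * g x ∂μ := by
  have hp_eq : p = α / (1 + α) := by rw [← inv_inj, hp]; field_simp; ring
  have hp0 : 0 < p := by rw [hp_eq]; positivity
  have hconj : p⁻¹.HolderConjugate (1 + α) := by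
    rw [Real.holderConjugate_iff, hp, ← hp, inv_inv, hp_eq]
    exact ⟨by rw [one_lt_inv₀ (by positivity), div_lt_one (by positivity)]; linarith,
      by field_simp; ring⟩
  have hfg := hf.mul hg
  have hI := hfg.integral_pos μ
  have hJ := (hg.rpow (-α)).integral_pos μ
  have holder := integral_mul_le_Lp_mul_Lq_of_nonneg (μ := μ) hconj
    (f := fun x => (f x * g x) ^ p) (g := fun x => g x ^ (-p))
    (Eventually.of_forall fun x => ((hfg.rpow p).pos x).le)
    (Eventually.of_forall fun x => ((hg.rpow (-p)).pos x).le)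
    ((hfg.rpow p).memLp _ μ) ((hg.rpow (-p)).memLp _ μ)
  have cancel : ∀ x, (f x * g x) ^ p * g x ^ (-p) = f x ^ p := fun x => by
    rw [Real.mul_rpow (hf.pos x).le (hg.pos x).le, Real.rpow_neg (hg.pos x).le,
      mul_inv_cancel_right₀ ((hg.rpow p).pos x).ne']
  have power : ∀ x, (g x ^ (-p)) ^ (1 + α) = g x ^ (-α) := fun x => by
    rw [← Real.rpow_mul (hg.pos x).le, hp_eq]; congr 1; field_simp
  simp only [cancel, power, Real.rpow_rpow_inv (hfg.pos _).le hp0.ne', one_div, inv_inv] at holder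
  set I := ∫ x, f x * g x ∂μ
  set J := ∫ x, g x ^ (-α) ∂μ
  calc (∫ x, f x ^ p ∂μ) ^ p⁻¹ * J ^ (-α)⁻¹
      ≤ (I ^ p * J ^ (1 + α)⁻¹) ^ p⁻¹ * J ^ (-α)⁻¹ := by
        gcongr; exact ((hf.rpow p).integral_pos μ).le
    _ = I * (J ^ ((1 + α)⁻¹ * p⁻¹) * J ^ (-α)⁻¹) := by
        rw [Real.mul_rpow (by positivity) (by positivity), Real.rpow_rpow_inv hI.le hp0.ne',
          ← Real.rpow_mul hJ.le, mul_assoc]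
    _ = I := by
        rw [← Real.rpow_add hJ, hp, show (1 + α)⁻¹ * (1 + α⁻¹) + (-α)⁻¹ = 0 by field_simp; ring,
          Real.rpow_zero, mul_one]

section ThinnedPair

variable {E : Type*} [MeasurableSpace E] [Zero E]

/-- The law of `(Y, B Y)` with `Y` of law `μ` and `B` an independent Bernoulli variable of
parameter `r`. -/
noncomputable def thinnedPair (μ : Measure E) (r : ℝ) : Measure (E × E) :=
  ENNReal.ofReal r • μ.map (fun y => (y, y)) + ENNReal.ofReal (1 - r) • μ.map (fun y => (y, 0))

lemma isProbabilityMeasure_thinnedPair (μ : Measure E) [IsProbabilityMeasure μ] {r : ℝ}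
    (hr : r ∈ Icc 0 1) : IsProbabilityMeasure (thinnedPair μ r) := by
  constructor
  rw [thinnedPair, Measure.add_apply, Measure.smul_apply, Measure.smul_apply,
    Measure.map_apply (by fun_prop) .univ, Measure.map_apply (by fun_prop) .univ,
    preimage_univ, preimage_univ, measure_univ, smul_eq_mul, smul_eq_mul, mul_one, mul_one,
    ← ENNReal.ofReal_add hr.1 (sub_nonneg.2 hr.2), add_sub_cancel, ENNReal.ofReal_one]

lemma integral_thinnedPair {G : Type*} [NormedAddCommGroup G] [NormedSpace ℝ G] (μ : Measure E)
    [IsFiniteMeasure μ] {r : ℝ} (hr : r ∈ Icc 0 1) {F : E × E → G} (hF : StronglyMeasurable F)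
    {C : ℝ} (hC : ∀ z, ‖F z‖ ≤ C) :
    ∫ z, F z ∂(thinnedPair μ r) = r • ∫ y, F (y, y) ∂μ + (1 - r) • ∫ y, F (y, 0) ∂μ := by
  have hint : ∀ κ : Measure (E × E), IsFiniteMeasure κ → Integrable F κ := fun κ _ =>
    Integrable.of_bound hF.aestronglyMeasurable C (Eventually.of_forall hC)
  rw [thinnedPair, integral_add_measure ((hint _ inferInstance).smul_measure ENNReal.ofReal_ne_top)
    ((hint _ inferInstance).smul_measure ENNReal.ofReal_ne_top), integral_smul_measure,
    integral_smul_measure, integral_map (by fun_prop) hF.aestronglyMeasurable,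
    integral_map (by fun_prop) hF.aestronglyMeasurable,
    ENNReal.toReal_ofReal hr.1, ENNReal.toReal_ofReal (sub_nonneg.2 hr.2)]

lemma BddPos.integral_thinnedPair {F : E × E → ℝ} (hF : BddPos F) (μ : Measure E)
    [IsFiniteMeasure μ] {r : ℝ} (hr : r ∈ Icc 0 1) :
    ∫ z, F z ∂(thinnedPair μ r) = r * ∫ y, F (y, y) ∂μ + (1 - r) * ∫ y, F (y, 0) ∂μ := by
  obtain ⟨C, hC⟩ := hF.exists_norm_le
  exact _root_.integral_thinnedPair μ hr hF.measurable.stronglyMeasurable hC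

lemma BddPos.thinning {h : E → ℝ} (hh : BddPos h) (h0 : h 0 = 1) {r : ℝ} (hr : r ∈ Icc 0 1) :
    BddPos fun y => r * h y + (1 - r) := by
  obtain ⟨c, C, hc, hcC⟩ := hh.exists_bounds
  have hc1 : c ≤ 1 := h0 ▸ (hcC 0).1
  refine ⟨(hh.measurable.const_mul r).add_const _, c, r * C + (1 - r), hc, fun x => ⟨?_, ?_⟩⟩
  · nlinarith [mul_le_mul_of_nonneg_left (hcC x).1 hr.1, hr.2]
  · nlinarith [mul_le_mul_of_nonneg_left (hcC x).2 hr.1]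

/-- Optimizing over `f` by the reverse Hölder inequality under `μ` leaves an inequality on `h`. -/
lemma ReverseHolder.thinnedPair_of_forall (μ : Measure E) [IsProbabilityMeasure μ]
    {r α β p K : ℝ} (hr : r ∈ Icc 0 1) (hα : 0 < α) (hp : p⁻¹ = 1 + α⁻¹) (hβ : 0 < β)
    (hK : 0 ≤ K)
    (H : ∀ h : E → ℝ, BddPos h → h 0 = 1 →
      (∫ y, (r * h y + (1 - r)) ^ (-α) ∂μ) ^ α⁻¹ ≤
        K * (r * (∫ y, h y ^ (-β) ∂μ) + (1 - r)) ^ β⁻¹) :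
    ReverseHolder (thinnedPair μ r) p (-β) K := by
  refine .of_normalized (neg_ne_zero.2 hβ.ne') 0 fun f h hf hh h0 => ?_
  have hP := hh.thinning h0 hr
  have integral_f : ∫ z, f z.1 ^ p ∂(thinnedPair μ r) = ∫ y, f y ^ p ∂μ := by
    rw [((hf.rpow p).comp measurable_fst).integral_thinnedPair μ hr]; ring
  have integral_h : ∫ z, h z.2 ^ (-β) ∂(thinnedPair μ r) =
      r * ∫ y, h y ^ (-β) ∂μ + (1 - r) := by
    rw [((hh.rpow (-β)).comp measurable_snd).integral_thinnedPair μ hr]; simp [h0]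
  have integral_fh : ∫ z, f z.1 * h z.2 ∂(thinnedPair μ r) =
      ∫ y, f y * (r * h y + (1 - r)) ∂μ := by
    rw [((hf.comp measurable_fst).mul (hh.comp measurable_snd)).integral_thinnedPair μ hr]
    dsimp only
    rw [← integral_const_mul, ← integral_const_mul,
      ← integral_add (((hf.mul hh).integrable μ).const_mul r)
        (((hf.mul (.const (hh.pos 0))).integrable μ).const_mul (1 - r))]
    exact integral_congr_ae (Eventually.of_forall fun y => by simp only [h0]; ring)
  rw [integral_f, integral_h, integral_fh]
  set X := ∫ y, (r * h y + (1 - r)) ^ (-α) ∂μ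
  set Y := r * (∫ y, h y ^ (-β) ∂μ) + (1 - r)
  have hX : 0 < X := (hP.rpow _).integral_pos μ
  have hY : 0 < Y := by
    have hV := (hh.rpow (-β)).integral_pos μ
    rcases hr.1.eq_or_lt with rfl | hr0
    · simp [Y]
    · have := mul_pos hr0 hV; linarith [hr.2]
  have h_le : Y ^ (-β)⁻¹ ≤ K * X ^ (-α)⁻¹ := by
    rw [inv_neg, inv_neg, Real.rpow_neg hY.le, Real.rpow_neg hX.le, ← div_eq_mul_inv,
      inv_eq_one_div, div_le_div_iff₀ (by positivity) (by positivity), one_mul]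
    exact H h hh h0
  calc _ ≤ (∫ y, f y ^ p ∂μ) ^ p⁻¹ * (K * X ^ (-α)⁻¹) :=
        mul_le_mul_of_nonneg_left h_le (Real.rpow_nonneg ((hf.rpow p).integral_pos μ).le _)
    _ = K * ((∫ y, f y ^ p ∂μ) ^ p⁻¹ * X ^ (-α)⁻¹) := by ring
    _ ≤ _ := mul_le_mul_of_nonneg_left (reverse_holder μ hα hp hf hP) hK

lemma ReverseHolder.thinnedPair_one (μ : Measure E) [IsProbabilityMeasure μ] {r α p : ℝ}
    (hr : r ∈ Ioc 0 1) (hα : 0 < α) (hp : p⁻¹ = 1 + α⁻¹) :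
    ReverseHolder (thinnedPair μ r) p (-(r * α)) 1 := by
  have hr0 : 0 < r := hr.1
  have hr' := Ioc_subset_Icc_self hr
  refine .thinnedPair_of_forall μ hr' hα hp (mul_pos hr0 hα) zero_le_one fun h hh h0 => ?_
  have amgm : ∀ {x : ℝ}, 0 ≤ x → x ^ r ≤ r * x + (1 - r) := fun {x} hx => by
    simpa using Real.geom_mean_le_arith_mean2_weighted hr0.le (sub_nonneg.2 hr.2) hx zero_le_one
      (by ring)
  have h_le : ∀ y, (r * h y + (1 - r)) ^ (-α) ≤ h y ^ (-(r * α)) := fun y => by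
    have hy := hh.pos y
    rw [← mul_neg, Real.rpow_mul hy.le]
    exact Real.rpow_le_rpow_of_nonpos (by positivity) (amgm hy.le) (by linarith)
  have hP := (hh.thinning h0 hr').rpow (-α)
  set V := ∫ y, h y ^ (-(r * α)) ∂μ
  have hV : 0 < V := (hh.rpow _).integral_pos μ
  calc (∫ y, (r * h y + (1 - r)) ^ (-α) ∂μ) ^ α⁻¹
      ≤ V ^ α⁻¹ := by
        gcongr
        · exact (hP.integral_pos μ).le
        · exact integral_mono (hP.integrable μ) ((hh.rpow _).integrable μ) h_le
    _ = (V ^ r) ^ (r * α)⁻¹ := by rw [← Real.rpow_mul hV.le]; congr 1; field_simp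
    _ ≤ 1 * (r * V + (1 - r)) ^ (r * α)⁻¹ := by
        rw [one_mul]; exact Real.rpow_le_rpow (by positivity) (amgm hV.le) (by positivity)

end ThinnedPair

section Atom

lemma rpow_div_one_add_mono {α β : ℝ} (hβ : 0 < β) (hβα : β ≤ α) :
    (β / (1 + β)) ^ (1 + β) ≤ (α / (1 + α)) ^ (1 + α) := by
  have hα : 0 < α := hβ.trans_le hβα
  have bernoulli := one_add_mul_self_le_rpow_one_add (s := -(1 + α)⁻¹) (p := (1 + α) / (1 + β))
    (neg_le_neg (inv_le_one_of_one_le₀ (by linarith)))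
    (by rw [le_div_iff₀ (by positivity)]; linarith)
  rw [show 1 + (1 + α) / (1 + β) * -(1 + α)⁻¹ = β / (1 + β) by field_simp; ring,
    show 1 + -(1 + α)⁻¹ = α / (1 + α) by field_simp; ring] at bernoulli
  refine (Real.rpow_le_rpow (by positivity) bernoulli (by positivity)).trans_eq ?_
  rw [← Real.rpow_mul (by positivity), div_mul_cancel₀ _ (by positivity)]

lemma mul_rpow_le_affine_rpow {α β r y : ℝ} (hβ : 0 < β) (hβα : β ≤ α)
    (hr : 1 + β = r * (1 + α)) (hy : 0 < y) :
    (α / (1 + α)) ^ α * (y / (β / (1 + β))) ^ β ≤ (r * y + (1 - r)) ^ α := by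
  have hα : 0 < α := hβ.trans_le hβα
  have hr_eq : r = (1 + β) / (1 + α) := by rw [hr]; field_simp
  have amgm := Real.geom_mean_le_arith_mean2_weighted (w₁ := β / α) (w₂ := 1 - β / α)
    (p₁ := y / (β / (1 + β))) (p₂ := 1) (by positivity)
    (sub_nonneg.2 ((div_le_one hα).2 hβα)) (by positivity) zero_le_one (by ring)
  rw [Real.one_rpow, mul_one] at amgm
  calc (α / (1 + α)) ^ α * (y / (β / (1 + β))) ^ β
      = (α / (1 + α) * (y / (β / (1 + β))) ^ (β / α)) ^ α := by
        rw [Real.mul_rpow (by positivity) (by positivity), ← Real.rpow_mul (by positivity) (β / α),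
          div_mul_cancel₀ _ hα.ne']
    _ ≤ (α / (1 + α) * (β / α * (y / (β / (1 + β))) + (1 - β / α) * 1)) ^ α := by gcongr
    _ = (r * y + (1 - r)) ^ α := by rw [hr_eq]; congr 1; field_simp; ring

lemma affine_rpow_neg_le {α β r y : ℝ} (hβ : 0 < β) (hβα : β ≤ α) (hr : 1 + β = r * (1 + α))
    (hy : 0 < y) : (r * y + (1 - r)) ^ (-α) ≤ α * r / β * y ^ (-β) := by
  have hα : 0 < α := hβ.trans_le hβα
  have hr_eq : r = (1 + β) / (1 + α) := by rw [hr]; field_simp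
  have hr1 : r ≤ 1 := by rw [hr_eq, div_le_one (by positivity)]; linarith
  have hP : 0 < r * y + (1 - r) := by
    rcases hr1.eq_or_lt with rfl | h
    · linarith
    · have : 0 < r := by rw [hr_eq]; positivity
      have := mul_pos this hy
      linarith
  have hmono := rpow_div_one_add_mono hβ hβα
  have hle := mul_rpow_le_affine_rpow hβ hβα hr hy
  rw [Real.div_rpow hy.le (by positivity)] at hle
  rw [Real.rpow_add (by positivity), Real.rpow_add (by positivity), Real.rpow_one,
    Real.rpow_one] at hmono
  rw [show α * r / β = α / (1 + α) / (β / (1 + β)) by rw [hr_eq]; field_simp,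
    Real.rpow_neg hP.le, Real.rpow_neg hy.le]
  set v := α / (1 + α)
  set w := β / (1 + β)
  have hv : 0 < v := by positivity
  have hw : 0 < w := by positivity
  calc ((r * y + (1 - r)) ^ α)⁻¹ ≤ (v ^ α * (y ^ β / w ^ β))⁻¹ := by gcongr
    _ = w ^ β / v ^ α * (y ^ β)⁻¹ := by field_simp
    _ ≤ v / w * (y ^ β)⁻¹ := by
        gcongr ?_ * _
        rw [div_le_div_iff₀ (by positivity) hw]
        linarith

lemma exp_sub_two_mul_sq_le {z : ℝ} (hz : -(1 / 2) ≤ z) : Real.exp (z - 2 * z ^ 2) ≤ 1 + z := by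
  have hpos : 0 < 1 - (z - 2 * z ^ 2) := by nlinarith [sq_nonneg (z - 1 / 4)]
  have hexp := Real.one_sub_le_exp_neg (z - 2 * z ^ 2)
  rw [Real.exp_neg] at hexp
  calc Real.exp (z - 2 * z ^ 2) ≤ (1 - (z - 2 * z ^ 2))⁻¹ := le_inv_of_le_inv₀ hpos hexp
    _ ≤ 1 + z := by
        rw [inv_le_iff_one_le_mul₀ hpos]
        nlinarith [mul_nonneg (sq_nonneg z) (by linarith : 0 ≤ 1 + 2 * z)]

lemma one_sub_add_rpow_inv_le {α β r q U V z : ℝ} (hα : 0 < α) (hβ : 0 < β) (hq : q ≤ 1)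
    (hU : 0 ≤ U) (hUV : U ≤ α * r / β * V) (hz : z = β / α * U - r * q) (hz_ge : -(1 / 2) ≤ z) :
    (1 - q + U) ^ α⁻¹ ≤ Real.exp (q * (r / β - α⁻¹) + 2 * z ^ 2 / β) *
      (r * (1 - q + V) + (1 - r)) ^ β⁻¹ := by
  have hU_le : 1 - q + U ≤ Real.exp (U - q) := by linarith [Real.add_one_le_exp (U - q)]
  have hV_ge : Real.exp (z - 2 * z ^ 2) ≤ r * (1 - q + V) + (1 - r) := by
    have : β / α * U ≤ r * V :=
      calc β / α * U ≤ β / α * (α * r / β * V) := by gcongr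
        _ = r * V := by field_simp
    linarith [exp_sub_two_mul_sq_le hz_ge]
  calc (1 - q + U) ^ α⁻¹ ≤ Real.exp (U - q) ^ α⁻¹ := by gcongr
    _ = Real.exp (q * (r / β - α⁻¹) + 2 * z ^ 2 / β) * Real.exp (z - 2 * z ^ 2) ^ β⁻¹ := by
        rw [← Real.exp_mul, ← Real.exp_mul, ← Real.exp_add, hz]; congr 1; field_simp; ring
    _ ≤ _ := by gcongr

lemma one_sub_add_rpow_inv_le_of_le {α β r q δ D U V : ℝ} (hβ : 0 < β) (hβα : β ≤ α)
    (hr : 1 + β = r * (1 + α)) (hq : q ∈ Icc 0 1) (hqδ : q ≤ δ) (hU : 0 ≤ U) (hUD : U ≤ D * q)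
    (hD : 0 ≤ D) (hUV : U ≤ α * r / β * V) (hδ : (r + β / α * D) * δ ≤ 1 / 2) :
    (1 - q + U) ^ α⁻¹ ≤ Real.exp (δ * (r / β - α⁻¹) + 2 * ((r + β / α * D) * δ) ^ 2 / β) *
      (r * (1 - q + V) + (1 - r)) ^ β⁻¹ := by
  have hα : 0 < α := hβ.trans_le hβα
  have hr_eq : r = (1 + β) / (1 + α) := by rw [hr]; field_simp
  have hr0 : 0 < r := by rw [hr_eq]; positivity
  have hV : 0 ≤ V := le_of_mul_le_mul_left (by simpa using hU.trans hUV)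
    (by positivity : 0 < α * r / β)
  have hA : 0 ≤ r / β - α⁻¹ := by
    rw [hr_eq, div_div, sub_nonneg, inv_le_iff_one_le_mul₀ hα, div_mul_eq_mul_div,
      one_le_div (by positivity)]
    linarith
  have hz_abs : |β / α * U - r * q| ≤ (r + β / α * D) * δ := by
    have hU' : β / α * U ≤ β / α * D * q := by rw [mul_assoc]; gcongr
    have hD' : β / α * D * q ≤ β / α * D * δ := by gcongr
    have hr' : r * q ≤ r * δ := by gcongr
    have := mul_nonneg hr0.le hq.1
    have : 0 ≤ β / α * U := by positivity
    rw [abs_le]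
    constructor <;> linarith
  have hr1 : 0 ≤ 1 - r := by
    rw [hr_eq, sub_nonneg, div_le_one (by positivity)]; linarith
  have hq1 : 0 ≤ 1 - q := sub_nonneg.2 hq.2
  refine (one_sub_add_rpow_inv_le hα hβ hq.2 hU hUV rfl
    ((neg_le_neg hδ).trans (abs_le.1 hz_abs).1)).trans ?_
  gcongr ?_ * _
  refine Real.exp_le_exp.2 (add_le_add (by gcongr) ?_)
  gcongr 2 * ?_ / _
  exact sq_le_sq' (abs_le.1 hz_abs).1 (abs_le.1 hz_abs).2

lemma integral_eq_one_sub_add {Ω : Type*} [MeasurableSpace Ω] [MeasurableSingletonClass Ω]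
    (μ : Measure Ω) [IsProbabilityMeasure μ] {x : Ω} {g : Ω → ℝ} (hg : Integrable g μ)
    (hx : g x = 1) : ∫ y, g y ∂μ = 1 - μ.real {x}ᶜ + ∫ y in {x}ᶜ, g y ∂μ := by
  rw [← integral_add_compl (measurableSet_singleton x) hg, integral_singleton, smul_eq_mul, hx,
    mul_one, probReal_compl_eq_one_sub (measurableSet_singleton x), sub_sub_cancel]

/-- The contributions of `{0}ᶜ` to both sides are compared pointwise; what remains is a first-order
expansion in the small mass of `{0}ᶜ`. -/
lemma ReverseHolder.thinnedPair_exp {E : Type*} [MeasurableSpace E] [Zero E]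
    [MeasurableSingletonClass E] (μ : Measure E) [IsProbabilityMeasure μ] {α β r p δ : ℝ}
    (hβ : 0 < β) (hβα : β < α) (hr : 1 + β = r * (1 + α)) (hp : p⁻¹ = 1 + α⁻¹)
    (hμδ : μ.real {0}ᶜ ≤ δ) (hδ : (r + β / α * (1 - r) ^ (-α)) * δ ≤ 1 / 2) :
    ReverseHolder (thinnedPair μ r) p (-β)
      (Real.exp (δ * (r / β - α⁻¹) + 2 * ((r + β / α * (1 - r) ^ (-α)) * δ) ^ 2 / β)) := by
  have hα : 0 < α := hβ.trans hβα
  have hr_eq : r = (1 + β) / (1 + α) := by rw [hr]; field_simp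
  have hr0 : 0 < r := by rw [hr_eq]; positivity
  have hr1 : r < 1 := by rw [hr_eq, div_lt_one (by positivity)]; linarith
  refine .thinnedPair_of_forall μ ⟨hr0.le, hr1.le⟩ hα hp hβ (Real.exp_pos _).le fun h hh h0 => ?_
  have hP := (hh.thinning h0 ⟨hr0.le, hr1.le⟩).rpow (-α)
  rw [integral_eq_one_sub_add μ (x := 0) (hP.integrable μ) (by simp [h0]),
    integral_eq_one_sub_add μ (x := 0) ((hh.rpow (-β)).integrable μ) (by simp [h0])]
  refine one_sub_add_rpow_inv_le_of_le hβ hβα.le hr ⟨measureReal_nonneg, measureReal_le_one⟩ hμδ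
    (integral_nonneg fun y => (hP.pos y).le) ?_ (Real.rpow_nonneg (by linarith) _) ?_ hδ
  · have hle : ∀ y, (r * h y + (1 - r)) ^ (-α) ≤ (1 - r) ^ (-α) := fun y =>
      Real.rpow_le_rpow_of_nonpos (by linarith)
        (le_add_of_nonneg_left (mul_pos hr0 (hh.pos y)).le) (by linarith)
    simpa [mul_comm] using
      integral_mono (hP.integrable (μ.restrict {0}ᶜ)) (integrable_const _) hle
  · rw [← integral_const_mul]
    exact integral_mono (hP.integrable _) (((hh.rpow (-β)).integrable _).const_mul _)
      fun y => affine_rpow_neg_le hβ hβα.le hr (hh.pos y)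

end Atom

section OneParameterSemigroup

variable {φ : ℝ → ℂ}

lemma continuousOn_Ici_of_map_add (hadd : ∀ s t, 0 ≤ s → 0 ≤ t → φ (s + t) = φ s * φ t)
    (hφ : ∀ t, 0 ≤ t → ‖φ t‖ ≤ 1) (hlim : Tendsto φ (𝓝[>] 0) (𝓝 1)) (h0 : φ 0 = 1) :
    ContinuousOn φ (Ici 0) := by
  have dist_le : ∀ s t, 0 ≤ s → s ≤ t → dist (φ s) (φ t) ≤ ‖φ (t - s) - 1‖ := fun s t hs hst => by
    have hw : 0 ≤ t - s := sub_nonneg.2 hst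
    rw [dist_comm, dist_eq_norm]
    calc ‖φ t - φ s‖ = ‖φ s‖ * ‖φ (t - s) - 1‖ := by
          rw [← norm_mul, mul_sub_one, ← hadd s _ hs hw, add_sub_cancel]
      _ ≤ _ := mul_le_of_le_one_left (norm_nonneg _) (hφ s hs)
  have hlim' : Tendsto (fun u => φ |u|) (𝓝 0) (𝓝 1) := by
    rw [← nhdsNE_sup_pure, tendsto_sup]
    exact ⟨hlim.comp tendsto_abs_nhdsNE_zero,
      by simpa [h0] using tendsto_pure_nhds (fun u : ℝ => φ |u|) 0⟩
  intro t ht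
  rw [ContinuousWithinAt, tendsto_iff_dist_tendsto_zero]
  have hsub : Tendsto (fun s => ‖φ |s - t| - 1‖) (𝓝[Ici 0] t) (𝓝 0) := by
    have hst : Tendsto (fun s => s - t) (𝓝[Ici 0] t) (𝓝 0) := by
      simpa using (continuous_sub_right t).continuousWithinAt.tendsto (x := t)
    simpa using ((hlim'.comp hst).sub_const 1).norm
  refine squeeze_zero' (Eventually.of_forall fun _ => dist_nonneg) ?_ hsub
  filter_upwards [self_mem_nhdsWithin] with s hs
  rcases le_total s t with h | h
  · rw [abs_sub_comm, abs_of_nonneg (sub_nonneg.2 h)]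
    exact dist_le s t hs h
  · rw [abs_of_nonneg (sub_nonneg.2 h), dist_comm]
    exact dist_le t s ht h

/-- Averaging `φ (t + u)` over small `u` shows that `φ` inherits differentiability from its
integral. -/
lemma exists_hasDerivAt_of_map_add (hadd : ∀ s t, 0 ≤ s → 0 ≤ t → φ (s + t) = φ s * φ t)
    (hcont : ContinuousOn φ (Ici 0)) (h0 : φ 0 = 1) :
    ∃ (F : ℝ → ℂ) (ψ : ℂ), ∀ t, 0 ≤ t → F t = φ t ∧ HasDerivAt F (ψ * φ t) t := by
  set g : ℝ → ℂ := fun t => φ (max t 0)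
  have hg : Continuous g := continuousOn_univ.1 <|
    hcont.comp (by fun_prop) fun t _ => le_max_right t 0
  have g_eq : ∀ {t}, 0 ≤ t → g t = φ t := fun {t} ht => by simp only [g, max_eq_left ht]
  set G : ℝ → ℂ := fun t => ∫ u in (0 : ℝ)..t, g u
  have hG : ∀ t, HasDerivAt G (g t) t := fun t => hg.integral_hasStrictDerivAt 0 t |>.hasDerivAt
  obtain ⟨c, hGc, hc⟩ : ∃ c, G c ≠ 0 ∧ 0 < c := by
    have hslope := (hG 0).eventually_ne (c := G 0) (by rw [g_eq le_rfl, h0]; exact one_ne_zero)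
    have := (hslope.filter_mono (nhdsGT_le_nhdsNE 0)).and self_mem_nhdsWithin
    simpa [G] using this.exists
  have average : ∀ t, 0 ≤ t → G (t + c) - G t = φ t * G c := fun t ht => by
    rw [intervalIntegral.integral_interval_sub_left (hg.intervalIntegrable _ _)
      (hg.intervalIntegrable _ _), ← intervalIntegral.integral_const_mul]
    have hshift := intervalIntegral.integral_comp_add_left (a := 0) (b := c) g t
    rw [add_zero] at hshift
    rw [← hshift]
    refine intervalIntegral.integral_congr fun u hu => ?_
    rw [uIcc_of_le hc.le] at hu
    simp only [g_eq hu.1, g_eq (add_nonneg ht hu.1), hadd t u ht hu.1]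
  refine ⟨fun t => (G (t + c) - G t) / G c, (φ c - 1) / G c, fun t ht => ⟨?_, ?_⟩⟩
  · dsimp only
    rw [average t ht, mul_div_cancel_right₀ _ hGc]
  · refine ((((hG (t + c)).comp_add_const t c).sub (hG t)).div_const (G c)).congr_deriv ?_
    rw [g_eq ht, g_eq (by positivity), hadd t c ht hc.le]
    ring

lemma exists_eq_exp_of_map_add (hadd : ∀ s t, 0 ≤ s → 0 ≤ t → φ (s + t) = φ s * φ t)
    (hφ : ∀ t, 0 ≤ t → ‖φ t‖ ≤ 1) (hlim : Tendsto φ (𝓝[>] 0) (𝓝 1)) (h0 : φ 0 = 1) :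
    ∃ ψ : ℂ, ∀ t, 0 ≤ t → φ t = Complex.exp (t * ψ) := by
  obtain ⟨F, ψ, hF⟩ :=
    exists_hasDerivAt_of_map_add hadd (continuousOn_Ici_of_map_add hadd hφ hlim h0) h0
  refine ⟨ψ, fun t ht => ?_⟩
  have hderiv : ∀ s, 0 ≤ s → HasDerivAt (fun u => F u * Complex.exp (-(u * ψ))) 0 s := by
    intro s hs
    obtain ⟨hFs, hF's⟩ := hF s hs
    have hexp : HasDerivAt (fun u : ℝ => Complex.exp (-(u * ψ)))
        (Complex.exp (-(s * ψ)) * -(1 * ψ)) s :=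
      (((hasDerivAt_id (s : ℂ)).comp_ofReal.mul_const ψ).neg).cexp
    exact (hF's.mul hexp).congr_deriv (by rw [hFs]; ring)
  have hconst := constant_of_has_deriv_right_zero (a := 0) (b := t)
    (fun s hs => (hderiv s hs.1).continuousAt.continuousWithinAt)
    (fun s hs => (hderiv s hs.1).hasDerivWithinAt) t ⟨ht, le_rfl⟩
  rw [(hF 0 le_rfl).1, h0, (hF t ht).1, Complex.exp_neg, mul_inv_eq_iff_eq_mul₀
    (Complex.exp_ne_zero _)] at hconst
  simpa using hconst

end OneParameterSemigroup

/-- The law of `(Y + Z, Y)` with `Y`, `Z` independent of laws `ρ`, `σ`. -/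
noncomputable def jointLaw {E : Type*} [Add E] [MeasurableSpace E] (ρ σ : Measure E) :
    Measure (E × E) :=
  (ρ.prod σ).map fun z => (z.1 + z.2, z.1)

instance {E : Type*} [Add E] [MeasurableSpace E] [MeasurableAdd₂ E] (ρ σ : Measure E)
    [IsProbabilityMeasure ρ] [IsProbabilityMeasure σ] : IsProbabilityMeasure (jointLaw ρ σ) :=
  Measure.isProbabilityMeasure_map (by fun_prop)

section CharFunDual

variable {E : Type*} [NormedAddCommGroup E] [NormedSpace ℝ E] [MeasurableSpace E]

lemma norm_charFunDual_le (κ : Measure E) [IsFiniteMeasure κ] (L : StrongDual ℝ E) :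
    ‖charFunDual κ L‖ ≤ κ.real univ := by
  rw [charFunDual_apply]
  simpa using norm_integral_le_of_norm_le_const (μ := κ)
    (Eventually.of_forall fun v => (Complex.norm_exp_ofReal_mul_I (L v)).le)

variable [BorelSpace E]

lemma integrable_exp_mul_I (κ : Measure E) [IsFiniteMeasure κ] (L : StrongDual ℝ E) :
    Integrable (fun v => Complex.exp (L v * Complex.I)) κ :=
  .of_bound (C := 1) (Measurable.aestronglyMeasurable (by fun_prop))
    (Eventually.of_forall fun v => (Complex.norm_exp_ofReal_mul_I _).le)

variable [SecondCountableTopology E]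

lemma charFunDual_convPow (κ : Measure E) [IsFiniteMeasure κ] (L : StrongDual ℝ E) (n : ℕ) :
    charFunDual (convPow κ n) L = charFunDual κ L ^ n := by
  induction n with
  | zero => simp [convPow]
  | succ n ih => rw [convPow, charFunDual_conv, ih, pow_succ]

lemma charFunDual_thinnedPair (κ : Measure E) [IsFiniteMeasure κ] {r : ℝ} (hr : r ∈ Icc 0 1)
    (L : StrongDual ℝ (E × E)) :
    charFunDual (thinnedPair κ r) L =
      r * charFunDual κ (L.comp ((ContinuousLinearMap.id ℝ E).prod (.id ℝ E))) +
        (1 - r) * charFunDual κ (L.comp (.inl ℝ E E)) := by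
  have hF : Continuous fun z : E × E => Complex.exp (L z * Complex.I) := by fun_prop
  rw [charFunDual_apply, integral_thinnedPair κ hr hF.stronglyMeasurable
    fun z => (Complex.norm_exp_ofReal_mul_I _).le]
  simp [charFunDual_apply]

lemma charFunDual_jointLaw (ρ σ : Measure E) [SFinite ρ] [SFinite σ] (L : StrongDual ℝ (E × E)) :
    charFunDual (jointLaw ρ σ) L =
      charFunDual ρ (L.comp ((ContinuousLinearMap.id ℝ E).prod (.id ℝ E))) *
        charFunDual σ (L.comp (.inl ℝ E E)) := by
  let T : E × E →L[ℝ] E × E :=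
    (ContinuousLinearMap.fst ℝ E E + ContinuousLinearMap.snd ℝ E E).prod
      (ContinuousLinearMap.fst ℝ E E)
  rw [show jointLaw ρ σ = (ρ.prod σ).map T from rfl, charFunDual_map, charFunDual_prod]
  congr 2 <;> ext v <;> simp [T]

end CharFunDual

lemma tendsto_integral_of_tendsto_charFunDual {G : Type*} [NormedAddCommGroup G] [NormedSpace ℝ G]
    [FiniteDimensional ℝ G] [MeasurableSpace G] [BorelSpace G] {κ : ℕ → Measure G} {κ₀ : Measure G}
    [∀ n, IsProbabilityMeasure (κ n)] [IsProbabilityMeasure κ₀]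
    (h : ∀ L, Tendsto (fun n => charFunDual (κ n) L) atTop (𝓝 (charFunDual κ₀ L))) {f : G → ℝ}
    (hf : Continuous f) {C : ℝ} (hC : ∀ x, ‖f x‖ ≤ C) :
    Tendsto (fun n => ∫ x, f x ∂(κ n)) atTop (𝓝 (∫ x, f x ∂κ₀)) := by
  set e : G ≃L[ℝ] EuclideanSpace ℝ (Fin (Module.finrank ℝ G)) := toEuclidean
  have charFun_eq : ∀ (κ : Measure G) t, charFun (κ.map e) t =
      charFunDual κ ((InnerProductSpace.toDualMap ℝ _ t).comp (e : G →L[ℝ] _)) := fun κ t => by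
    rw [charFun_eq_charFunDual_toDualMap, ← charFunDual_map]; rfl
  let law (κ : Measure G) [IsProbabilityMeasure κ] :
      ProbabilityMeasure (EuclideanSpace ℝ (Fin (Module.finrank ℝ G))) :=
    ⟨κ.map e, Measure.isProbabilityMeasure_map (by fun_prop)⟩
  have weak : Tendsto (fun n => law (κ n)) atTop (𝓝 (law κ₀)) :=
    ProbabilityMeasure.tendsto_of_tendsto_charFun fun t => by
      simpa only [law, ProbabilityMeasure.coe_mk, charFun_eq] using h _
  have integral_eq : ∀ κ : Measure G, ∫ y, f (e.symm y) ∂(κ.map e) = ∫ x, f x ∂κ := fun κ => by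
    rw [integral_map (f := fun y => f (e.symm y)) (by fun_prop)
      (Continuous.aestronglyMeasurable (by fun_prop))]
    simp
  simp only [← integral_eq]
  exact ProbabilityMeasure.tendsto_iff_forall_integral_tendsto.1 weak
    (.ofNormedAddCommGroup (fun y => f (e.symm y)) (by fun_prop) C fun y => hC _)

/-- The probability measures `μ t`, `t ≥ 0`, have characteristic functions `exp (t ψ)`: `ψ` is the
characteristic (Lévy–Khintchine) exponent of the convolution semigroup `μ`. -/
structure HasCharExponent {E : Type*} [NormedAddCommGroup E] [NormedSpace ℝ E] [MeasurableSpace E]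
    (μ : ℝ → Measure E) (ψ : StrongDual ℝ E → ℂ) : Prop where
  isProbabilityMeasure : ∀ t, 0 ≤ t → IsProbabilityMeasure (μ t)
  charFunDual_eq : ∀ t, 0 ≤ t → ∀ L, charFunDual (μ t) L = Complex.exp (t * ψ L)

section CharExponent

variable {E : Type*} [NormedAddCommGroup E] [NormedSpace ℝ E] [MeasurableSpace E] [BorelSpace E]
  {μ : ℝ → Measure E} {ψ : StrongDual ℝ E → ℂ}

lemma IsConvolutionSemigroup.tendsto_charFunDual (hμ : IsConvolutionSemigroup μ)
    (L : StrongDual ℝ E) : Tendsto (fun t => charFunDual (μ t) L) (𝓝[>] 0) (𝓝 1) := by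
  have hcos := hμ.tendsto_zero (fun y => Real.cos (L y)) (by fun_prop)
    ⟨1, fun y => Real.abs_cos_le_one _⟩
  have hsin := hμ.tendsto_zero (fun y => Real.sin (L y)) (by fun_prop)
    ⟨1, fun y => Real.abs_sin_le_one _⟩
  have hlim := ((Complex.continuous_ofReal.tendsto _).comp hcos).add
    (((Complex.continuous_ofReal.tendsto _).comp hsin).mul_const Complex.I)
  simp only [map_zero, Real.cos_zero, Real.sin_zero, Complex.ofReal_one, Complex.ofReal_zero,
    zero_mul, add_zero] at hlim
  refine hlim.congr' ?_
  filter_upwards [self_mem_nhdsWithin] with t ht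
  have := hμ.isProbabilityMeasure t (le_of_lt ht)
  have hint := integrable_exp_mul_I (μ t) L
  rw [charFunDual_apply, ← integral_re_add_im hint]
  simp [Complex.exp_ofReal_mul_I_re, Complex.exp_ofReal_mul_I_im]

lemma HasCharExponent.map_add_smul (hμ : HasCharExponent μ ψ) (b : E) :
    HasCharExponent (fun t => (μ t).map (· + t • b)) (fun L => ψ L + L b * Complex.I) where
  isProbabilityMeasure t ht :=
    have := hμ.isProbabilityMeasure t ht
    Measure.isProbabilityMeasure_map (by fun_prop)
  charFunDual_eq t ht L := by
    rw [charFunDual_map_add_const, hμ.charFunDual_eq t ht, ← Complex.exp_add, map_smul, smul_eq_mul]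
    push_cast
    ring_nf

variable [SecondCountableTopology E]

lemma IsConvolutionSemigroup.exists_hasCharExponent (hμ : IsConvolutionSemigroup μ) :
    ∃ ψ, HasCharExponent μ ψ := by
  have hprob := hμ.isProbabilityMeasure
  have : ∀ L : StrongDual ℝ E, ∃ ψ : ℂ, ∀ t : ℝ, 0 ≤ t →
      charFunDual (μ t) L = Complex.exp (t * ψ) := fun L => by
    refine exists_eq_exp_of_map_add (fun s t hs ht => ?_) (fun t ht => ?_)
      (hμ.tendsto_charFunDual L) (by simp [hμ.zero])
    · have := hprob s hs
      have := hprob t ht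
      rw [hμ.add s t hs ht, charFunDual_conv]
    · have := hprob t ht
      simpa using norm_charFunDual_le (μ t) L
  choose ψ hψ using this
  exact ⟨ψ, hprob, fun t ht L => hψ L t ht⟩

namespace HasCharExponent

variable [CompleteSpace E]

lemma unique {μ' : ℝ → Measure E} (hμ : HasCharExponent μ ψ) (hμ' : HasCharExponent μ' ψ) {t : ℝ}
    (ht : 0 ≤ t) : μ t = μ' t := by
  have := hμ.isProbabilityMeasure t ht
  have := hμ'.isProbabilityMeasure t ht
  exact Measure.ext_of_charFunDual <| funext fun L => by
    rw [hμ.charFunDual_eq t ht, hμ'.charFunDual_eq t ht]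

end HasCharExponent

end CharExponent

lemma tendsto_pow_of_hasDerivAt {f : ℝ → ℂ} {a : ℂ} (hf : HasDerivAt f a 0) (h0 : f 0 = 1) :
    Tendsto (fun n : ℕ => f (n : ℝ)⁻¹ ^ n) atTop (𝓝 (Complex.exp a)) := by
  have hslope : Tendsto (fun n : ℕ => (n : ℂ) * (f (n : ℝ)⁻¹ - 1)) atTop (𝓝 a) := by
    have hinv := tendsto_inv_atTop_nhdsGT_zero.comp (tendsto_natCast_atTop_atTop (R := ℝ))
    simpa [Function.comp_def, h0] using hf.tendsto_slope_zero_right.comp hinv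
  simpa using Complex.tendsto_one_add_pow_exp_of_tendsto hslope

lemma HasCharExponent.tendsto_integral_convPow_thinnedPair {E : Type*} [NormedAddCommGroup E]
    [NormedSpace ℝ E] [FiniteDimensional ℝ E] [MeasurableSpace E] [BorelSpace E]
    {μ : ℝ → Measure E} {ψ : StrongDual ℝ E → ℂ} (hμ : HasCharExponent μ ψ) {r t : ℝ}
    (hr : r ∈ Icc 0 1) (ht : 0 ≤ t) {F : E × E → ℝ} (hF : Continuous F) (hF' : BddPos F) :
    Tendsto (fun n : ℕ => ∫ z, F z ∂(convPow (thinnedPair (μ (t / n)) r) n)) atTop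
      (𝓝 (∫ z, F z ∂(jointLaw (μ (r * t)) (μ ((1 - r) * t))))) := by
  have hrt : 0 ≤ r * t := mul_nonneg hr.1 ht
  have hrt' : 0 ≤ (1 - r) * t := mul_nonneg (sub_nonneg.2 hr.2) ht
  have htn : ∀ n : ℕ, 0 ≤ t / n := fun n => by positivity
  have := hμ.isProbabilityMeasure _ hrt
  have := hμ.isProbabilityMeasure _ hrt'
  have := fun n : ℕ => hμ.isProbabilityMeasure _ (htn n)
  have := fun n : ℕ => isProbabilityMeasure_thinnedPair (μ (t / n)) hr
  obtain ⟨C, hC⟩ := hF'.exists_norm_le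
  refine tendsto_integral_of_tendsto_charFunDual (fun L => ?_) hF hC
  rw [charFunDual_jointLaw, hμ.charFunDual_eq _ hrt, hμ.charFunDual_eq _ hrt', ← Complex.exp_add]
  simp only [charFunDual_convPow, charFunDual_thinnedPair _ hr, hμ.charFunDual_eq _ (htn _)]
  set ψ₁ := ψ (L.comp ((ContinuousLinearMap.id ℝ E).prod (.id ℝ E)))
  set ψ₂ := ψ (L.comp (.inl ℝ E E))
  have hexp : ∀ w : ℂ, HasDerivAt (fun x : ℝ => Complex.exp (x * (t * w))) (t * w) 0 := fun w => by
    simpa using ((hasDerivAt_id (0 : ℂ)).mul_const (t * w)).cexp.comp_ofReal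
  have hlim := tendsto_pow_of_hasDerivAt (((hexp ψ₁).const_mul (r : ℂ)).add
    ((hexp ψ₂).const_mul (1 - r : ℂ))) (by simp)
  convert hlim using 4 with n
  · push_cast; simp only [Pi.add_apply]; congr 3 <;> (push_cast; ring)
  all_goals push_cast; ring

namespace BddPos

variable {α : Type*} [MeasurableSpace α]

lemma tendsto_integral {μ : Measure α} [IsFiniteMeasure μ] {G : ℕ × α → ℝ} {f : α → ℝ}
    (hG : BddPos G) (h : ∀ᵐ x ∂μ, Tendsto (fun n => G (n, x)) atTop (𝓝 (f x))) :
    Tendsto (fun n => ∫ x, G (n, x) ∂μ) atTop (𝓝 (∫ x, f x ∂μ)) := by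
  obtain ⟨C, hC⟩ := hG.exists_norm_le
  exact tendsto_integral_of_dominated_convergence (fun _ => C)
    (fun n => (hG.comp measurable_prodMk_left).measurable.aestronglyMeasurable)
    (integrable_const C) (fun n => Eventually.of_forall fun x => hC _) h

lemma exists_seq_continuous_tendsto_ae [TopologicalSpace α] [NormalSpace α] [BorelSpace α]
    (μ : Measure α) [IsFiniteMeasure μ] [μ.WeaklyRegular] {f : α → ℝ} (hf : BddPos f) :
    ∃ G : ℕ × α → ℝ, BddPos G ∧ (∀ n, Continuous fun x => G (n, x)) ∧
      ∀ᵐ x ∂μ, Tendsto (fun n => G (n, x)) atTop (𝓝 (f x)) := by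
  obtain ⟨c, C, hc, hcC⟩ := hf.exists_bounds
  have hfL := hf.memLp 1 μ
  choose u hu hu_mem using fun n : ℕ => hfL.exists_boundedContinuous_eLpNorm_sub_le
    ENNReal.one_ne_top (ε := (n : ℝ≥0∞)⁻¹) (by simp)
  have hlim : Tendsto (fun n => eLpNorm (⇑(u n) - f) 1 μ) atTop (𝓝 0) := by
    simp only [← eLpNorm_sub_comm f]
    exact tendsto_of_tendsto_of_tendsto_of_le_of_le tendsto_const_nhds
      ENNReal.tendsto_inv_nat_nhds_zero (fun _ => zero_le) hu
  obtain ⟨φ, -, hφ⟩ := (tendstoInMeasure_of_tendsto_eLpNorm one_ne_zero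
    (fun n => (hu_mem n).1) hfL.1 hlim).exists_seq_tendsto_ae
  refine ⟨fun z => max c (min (u (φ z.1) z.2) (max c C)), ⟨?_, c, max c C, hc, fun z => ?_⟩,
    fun n => by fun_prop, hφ.mono fun x hx => ?_⟩
  · exact measurable_from_prod_countable_right fun n =>
      measurable_const.max ((u (φ n)).continuous.measurable.min measurable_const)
  · exact ⟨le_max_left _ _, max_le (le_max_left _ _) (min_le_right _ _)⟩
  · have := tendsto_const_nhds (x := c).max (hx.min (tendsto_const_nhds (x := max c C)))
    rwa [min_eq_left ((hcC x).2.trans (le_max_right _ _)), max_eq_right (hcC x).1] at this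

end BddPos

lemma ReverseHolder.of_continuous {α β : Type*} [TopologicalSpace α] [NormalSpace α]
    [MeasurableSpace α] [BorelSpace α] [TopologicalSpace β] [NormalSpace β] [MeasurableSpace β]
    [BorelSpace β] {κ : Measure (α × β)} [IsProbabilityMeasure κ] [(κ.map Prod.fst).WeaklyRegular]
    [(κ.map Prod.snd).WeaklyRegular] {p q K : ℝ}
    (H : ∀ (f : α → ℝ) (h : β → ℝ), BddPos f → BddPos h → Continuous f → Continuous h →
      (∫ z, f z.1 ^ p ∂κ) ^ p⁻¹ * (∫ z, h z.2 ^ q ∂κ) ^ q⁻¹ ≤ K * ∫ z, f z.1 * h z.2 ∂κ) :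
    ReverseHolder κ p q K := by
  intro f h hf hh
  obtain ⟨F, hF, hFc, hFlim⟩ := hf.exists_seq_continuous_tendsto_ae (κ.map Prod.fst)
  obtain ⟨G, hG, hGc, hGlim⟩ := hh.exists_seq_continuous_tendsto_ae (κ.map Prod.snd)
  replace hFlim := ae_of_ae_map (by fun_prop) hFlim
  replace hGlim := ae_of_ae_map (by fun_prop) hGlim
  have hF' := hF.comp (φ := fun z : ℕ × (α × β) => (z.1, z.2.1)) (by fun_prop)
  have hG' := hG.comp (φ := fun z : ℕ × (α × β) => (z.1, z.2.2)) (by fun_prop)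
  have limF : Tendsto (fun n => ∫ z, F (n, z.1) ^ p ∂κ) atTop (𝓝 (∫ z, f z.1 ^ p ∂κ)) :=
    (hF'.rpow p).tendsto_integral <| hFlim.mono fun z hz => hz.rpow_const (.inl (hf.pos _).ne')
  have limG : Tendsto (fun n => ∫ z, G (n, z.2) ^ q ∂κ) atTop (𝓝 (∫ z, h z.2 ^ q ∂κ)) :=
    (hG'.rpow q).tendsto_integral <| hGlim.mono fun z hz => hz.rpow_const (.inl (hh.pos _).ne')
  have limFG : Tendsto (fun n => ∫ z, F (n, z.1) * G (n, z.2) ∂κ) atTop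
      (𝓝 (∫ z, f z.1 * h z.2 ∂κ)) :=
    (hF'.mul hG').tendsto_integral <| by
      filter_upwards [hFlim, hGlim] with z hz hz' using hz.mul hz'
  have posF := ((hf.rpow p).comp (φ := fun z : α × β => z.1) measurable_fst).integral_pos κ
  have posG := ((hh.rpow q).comp (φ := fun z : α × β => z.2) measurable_snd).integral_pos κ
  exact le_of_tendsto_of_tendsto' ((limF.rpow_const (.inl posF.ne')).mul
    (limG.rpow_const (.inl posG.ne'))) (limFG.const_mul K) fun n =>
      H _ _ (hF.comp measurable_prodMk_left) (hG.comp measurable_prodMk_left) (hFc n) (hGc n)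

lemma HasCharExponent.reverseHolder_jointLaw {E : Type*} [NormedAddCommGroup E] [NormedSpace ℝ E]
    [FiniteDimensional ℝ E] [MeasurableSpace E] [BorelSpace E] {μ : ℝ → Measure E}
    {ψ : StrongDual ℝ E → ℂ} (hμ : HasCharExponent μ ψ) {r t p q K : ℝ} (hr : r ∈ Icc 0 1)
    (ht : 0 ≤ t) (hp : p ≠ 0) (hq : q ≠ 0) {k : ℕ → ℝ} (hk : ∀ n, 0 ≤ k n)
    (hkK : Tendsto (fun n => k n ^ n) atTop (𝓝 K))
    (h : ∀ᶠ n : ℕ in atTop, ReverseHolder (thinnedPair (μ (t / n)) r) p q (k n)) :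
    ReverseHolder (jointLaw (μ (r * t)) (μ ((1 - r) * t))) p q K := by
  have := hμ.isProbabilityMeasure _ (mul_nonneg hr.1 ht)
  have := hμ.isProbabilityMeasure _ (mul_nonneg (sub_nonneg.2 hr.2) ht)
  have hprob : ∀ n : ℕ, IsProbabilityMeasure (thinnedPair (μ (t / n)) r) := fun n =>
    have := hμ.isProbabilityMeasure (t / n) (by positivity)
    isProbabilityMeasure_thinnedPair _ hr
  refine .of_continuous fun f h' hf hh hfc hhc => ?_
  have bf := (hf.rpow p).comp (φ := fun z : E × E => z.1) measurable_fst
  have bh := (hh.rpow q).comp (φ := fun z : E × E => z.2) measurable_snd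
  have bfh := (hf.comp (φ := fun z : E × E => z.1) measurable_fst).mul
    (hh.comp (φ := fun z : E × E => z.2) measurable_snd)
  have cf : Continuous fun z : E × E => f z.1 ^ p :=
    (hfc.comp continuous_fst).rpow_const fun z => .inl (hf.pos _).ne'
  have ch : Continuous fun z : E × E => h' z.2 ^ q :=
    (hhc.comp continuous_snd).rpow_const fun z => .inl (hh.pos _).ne'
  have limf := hμ.tendsto_integral_convPow_thinnedPair hr ht cf bf
  have limh := hμ.tendsto_integral_convPow_thinnedPair hr ht ch bh
  have limfh := hμ.tendsto_integral_convPow_thinnedPair hr ht (by fun_prop) bfh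
  refine le_of_tendsto_of_tendsto ((limf.rpow_const (.inl (bf.integral_pos _).ne')).mul
    (limh.rpow_const (.inl (bh.integral_pos _).ne'))) (hkK.mul limfh) ?_
  filter_upwards [h] with n hn
  exact hn.convPow hp hq (hk n) n f h' hf hh

section Conv

variable {E : Type*} [AddMonoid E] [MeasurableSpace E] [MeasurableAdd₂ E] {ρ σ : Measure E}
  [IsProbabilityMeasure ρ] [IsProbabilityMeasure σ]

lemma BddPos.integral_comp_add {f : E → ℝ} (hf : BddPos f) :
    BddPos fun y => ∫ z, f (y + z) ∂σ :=
  (hf.comp (φ := fun z : E × E => z.1 + z.2) (by fun_prop)).integral_prod_right σ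

lemma BddPos.integral_jointLaw {F : E × E → ℝ} (hF : BddPos F) :
    ∫ z, F z ∂(jointLaw ρ σ) = ∫ y, ∫ z, F (y + z, y) ∂σ ∂ρ := by
  rw [jointLaw, integral_map (by fun_prop) hF.measurable.aestronglyMeasurable,
    integral_prod _ ((hF.comp (by fun_prop)).integrable _)]

/-- The reverse Hölder inequality applied with `h = (σ f) ^ (q₂ - 1)`, whose power of exponent
`-(q₂ / (1 - q₂))` is `(σ f) ^ q₂`. -/
lemma ReverseHolder.integral_rpow_le {q₁ q₂ K : ℝ} (hq₂ : q₂ ∈ Ioo 0 1)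
    (H : ReverseHolder (jointLaw ρ σ) q₁ (-(q₂ / (1 - q₂))) K) {f : E → ℝ} (hf : BddPos f) :
    (∫ y, f y ^ q₁ ∂(ρ.conv σ)) ^ q₁⁻¹ ≤ K * (∫ y, (∫ z, f (y + z) ∂σ) ^ q₂ ∂ρ) ^ q₂⁻¹ := by
  obtain ⟨hq₂0, hq₂1⟩ := hq₂
  have : 0 < 1 - q₂ := sub_pos.2 hq₂1
  set g : E → ℝ := fun y => ∫ z, f (y + z) ∂σ
  have hg : ∀ y, ∫ z, f (y + z) ∂σ = g y := fun _ => rfl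
  have bg : BddPos g := hf.integral_comp_add
  have main := H f (fun y => g y ^ (q₂ - 1)) hf (bg.rpow _)
  have hpow : ∀ y, (g y ^ (q₂ - 1)) ^ (-(q₂ / (1 - q₂))) = g y ^ q₂ := fun y => by
    rw [← Real.rpow_mul (bg.pos y).le]
    congr 1
    field_simp
    ring
  have hmul : ∀ y, g y * g y ^ (q₂ - 1) = g y ^ q₂ := fun y => by
    rw [← Real.rpow_one_add' (bg.pos y).le (by linarith), add_sub_cancel]
  have bf₁ : BddPos fun z : E × E => f z.1 ^ q₁ := (hf.rpow q₁).comp measurable_fst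
  have bg₂ : BddPos fun z : E × E => g z.2 ^ q₂ := (bg.rpow q₂).comp measurable_snd
  have bfg : BddPos fun z : E × E => f z.1 * g z.2 ^ (q₂ - 1) :=
    (hf.comp measurable_fst).mul ((bg.rpow (q₂ - 1)).comp measurable_snd)
  simp only [hpow] at main
  rw [bf₁.integral_jointLaw, bg₂.integral_jointLaw, bfg.integral_jointLaw] at main
  simp only [integral_const, probReal_univ, one_smul, integral_mul_const] at main
  rw [integral_conv ((hf.rpow q₁).integrable _)]
  simp only [hg, hmul] at main ⊢
  set G := ∫ y, g y ^ q₂ ∂ρ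
  have hG : 0 < G := (bg.rpow q₂).integral_pos ρ
  have hexp : G ^ (-(q₂ / (1 - q₂)))⁻¹ * G ^ q₂⁻¹ = G := by
    rw [← Real.rpow_add hG]
    convert Real.rpow_one G using 2
    field_simp
    ring
  refine le_of_mul_le_mul_right ?_ (Real.rpow_pos_of_pos hG (-(q₂ / (1 - q₂)))⁻¹)
  rwa [mul_assoc, mul_comm (G ^ q₂⁻¹), hexp]

end Conv

section Extension

lemma BddPos.ofReal_integral {α : Type*} [MeasurableSpace α] (μ : Measure α) [IsFiniteMeasure μ]
    {f : α → ℝ} (hf : BddPos f) :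
    ENNReal.ofReal (∫ x, f x ∂μ) = ∫⁻ x, ENNReal.ofReal (f x) ∂μ :=
  ofReal_integral_eq_lintegral_ofReal (hf.integrable μ)
    (Eventually.of_forall fun x => (hf.pos x).le)

lemma BddPos.ofReal_integral_rpow {α : Type*} [MeasurableSpace α] (μ : Measure α)
    [IsFiniteMeasure μ] {f : α → ℝ} (hf : BddPos f) (q : ℝ) :
    ENNReal.ofReal (∫ x, f x ^ q ∂μ) = ∫⁻ x, ENNReal.ofReal (f x) ^ q ∂μ := by
  rw [(hf.rpow q).ofReal_integral μ]
  exact lintegral_congr fun x => (ENNReal.ofReal_rpow_of_pos (hf.pos x)).symm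

namespace ReverseHolder

variable {E : Type*} [AddMonoid E] [MeasurableSpace E] [MeasurableAdd₂ E] {ρ σ : Measure E}
  [IsProbabilityMeasure ρ] [IsProbabilityMeasure σ] {q₁ q₂ K : ℝ}

lemma lintegral_ofReal_rpow_le (hq₂ : q₂ ∈ Ioo 0 1) (hK : 0 ≤ K)
    (H : ReverseHolder (jointLaw ρ σ) q₁ (-(q₂ / (1 - q₂))) K) {f : E → ℝ} (hf : BddPos f) :
    (∫⁻ y, ENNReal.ofReal (f y) ^ q₁ ∂(ρ.conv σ)) ^ q₁⁻¹ ≤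
      ENNReal.ofReal K * (∫⁻ y, (∫⁻ z, ENNReal.ofReal (f (y + z)) ∂σ) ^ q₂ ∂ρ) ^ q₂⁻¹ := by
  have bg : BddPos fun y => ∫ z, f (y + z) ∂σ := hf.integral_comp_add
  have hg : ∀ y, ENNReal.ofReal (∫ z, f (y + z) ∂σ) = ∫⁻ z, ENNReal.ofReal (f (y + z)) ∂σ :=
    fun y => (hf.comp (φ := (y + ·)) (by fun_prop)).ofReal_integral σ
  simp only [← hg]
  rw [← hf.ofReal_integral_rpow (ρ.conv σ), ← bg.ofReal_integral_rpow ρ,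
    ENNReal.ofReal_rpow_of_pos ((hf.rpow _).integral_pos _),
    ENNReal.ofReal_rpow_of_pos ((bg.rpow _).integral_pos _), ← ENNReal.ofReal_mul hK]
  exact ENNReal.ofReal_le_ofReal (H.integral_rpow_le hq₂ hf)

lemma lintegral_min_natCast_rpow_le (hq₁ : 0 < q₁) (hq₂ : q₂ ∈ Ioo 0 1) (hK : 0 ≤ K)
    (H : ReverseHolder (jointLaw ρ σ) q₁ (-(q₂ / (1 - q₂))) K) {f : E → ℝ≥0∞}
    (hf : Measurable f) (n : ℕ) {ε : ℝ} (hε : 0 < ε) :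
    (∫⁻ y, (min (f y) n) ^ q₁ ∂(ρ.conv σ)) ^ q₁⁻¹ ≤ ENNReal.ofReal K *
      (∫⁻ y, (∫⁻ z, f (y + z) ∂σ) ^ q₂ ∂ρ + ENNReal.ofReal ε ^ q₂) ^ q₂⁻¹ := by
  set g : E → ℝ := fun y => (min (f y) n).toReal + ε
  have hfn : ∀ y, min (f y) n ≠ ⊤ := fun y =>
    ((min_le_right _ _).trans_lt (ENNReal.natCast_lt_top n)).ne
  have hg : ∀ y, ENNReal.ofReal (g y) = min (f y) n + ENNReal.ofReal ε := fun y => by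
    rw [ENNReal.ofReal_add ENNReal.toReal_nonneg hε.le, ENNReal.ofReal_toReal (hfn y)]
  have bg : BddPos g := by
    refine ⟨by fun_prop, ε, n + ε, hε, fun y => ⟨le_add_of_nonneg_left ENNReal.toReal_nonneg, ?_⟩⟩
    exact add_le_add (ENNReal.toReal_le_of_le_ofReal n.cast_nonneg (by simp)) le_rfl
  have main := H.lintegral_ofReal_rpow_le hq₂ hK bg
  simp only [hg] at main
  obtain ⟨hq₂0, hq₂1⟩ := hq₂
  calc (∫⁻ y, (min (f y) n) ^ q₁ ∂(ρ.conv σ)) ^ q₁⁻¹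
      ≤ (∫⁻ y, (min (f y) n + ENNReal.ofReal ε) ^ q₁ ∂(ρ.conv σ)) ^ q₁⁻¹ := by
        gcongr
        exact le_self_add
    _ ≤ _ := main
    _ ≤ ENNReal.ofReal K *
        (∫⁻ y, ((∫⁻ z, f (y + z) ∂σ) ^ q₂ + ENNReal.ofReal ε ^ q₂) ∂ρ) ^ q₂⁻¹ := by
        gcongr with y
        refine le_trans ?_ (ENNReal.rpow_add_le_add_rpow _ _ hq₂0.le hq₂1.le)
        gcongr
        refine (lintegral_mono fun z => add_le_add_left (min_le_left _ _) _).trans_eq ?_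
        simp [lintegral_add_right]
    _ = _ := by simp [lintegral_add_right]

theorem lintegral_rpow_le (hq₁ : 0 < q₁) (hq₂ : q₂ ∈ Ioo 0 1) (hK : 0 ≤ K)
    (H : ReverseHolder (jointLaw ρ σ) q₁ (-(q₂ / (1 - q₂))) K) {f : E → ℝ≥0∞}
    (hf : Measurable f) :
    (∫⁻ y, f y ^ q₁ ∂(ρ.conv σ)) ^ q₁⁻¹ ≤
      ENNReal.ofReal K * (∫⁻ y, (∫⁻ z, f (y + z) ∂σ) ^ q₂ ∂ρ) ^ q₂⁻¹ := by
  have truncation : ∀ n : ℕ, (∫⁻ y, (min (f y) n) ^ q₁ ∂(ρ.conv σ)) ^ q₁⁻¹ ≤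
      ENNReal.ofReal K * (∫⁻ y, (∫⁻ z, f (y + z) ∂σ) ^ q₂ ∂ρ) ^ q₂⁻¹ := fun n => by
    have hε : Tendsto (fun ε => ENNReal.ofReal ε ^ q₂) (𝓝[>] 0) (𝓝 0) := by
      have := (ENNReal.tendsto_ofReal (tendsto_id (x := 𝓝 (0 : ℝ)))).ennrpow_const q₂
      simpa [ENNReal.zero_rpow_of_pos hq₂.1] using this.mono_left nhdsWithin_le_nhds
    have hlim := ENNReal.Tendsto.const_mul (((tendsto_const_nhds
      (x := ∫⁻ y, (∫⁻ z, f (y + z) ∂σ) ^ q₂ ∂ρ)).add hε).ennrpow_const q₂⁻¹)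
      (.inr (ENNReal.ofReal_ne_top (r := K)))
    simp only [add_zero] at hlim
    refine ge_of_tendsto hlim ?_
    filter_upwards [self_mem_nhdsWithin] with ε hε
    exact H.lintegral_min_natCast_rpow_le hq₁ hq₂ hK hf n hε
  have hlim : Tendsto (fun n : ℕ => ∫⁻ y, (min (f y) n) ^ q₁ ∂(ρ.conv σ)) atTop
      (𝓝 (∫⁻ y, f y ^ q₁ ∂(ρ.conv σ))) := by
    refine lintegral_tendsto_of_tendsto_of_monotone (fun n => by fun_prop)
      (Eventually.of_forall fun y m n hmn => ?_) (Eventually.of_forall fun y => ?_)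
    · dsimp only
      gcongr
    · refine Tendsto.ennrpow_const q₁ ?_
      simpa using (tendsto_const_nhds (x := f y)).min ENNReal.tendsto_nat_nhds_top
  exact le_of_tendsto' (hlim.ennrpow_const q₁⁻¹) truncation

end ReverseHolder

end Extension

lemma ReverseHolder.map {α β α' β' : Type*} [MeasurableSpace α] [MeasurableSpace β]
    [MeasurableSpace α'] [MeasurableSpace β'] {κ : Measure (α × β)} {p q K : ℝ}
    (H : ReverseHolder κ p q K) {φ : α → α'} {χ : β → β'} (hφ : Measurable φ)
    (hχ : Measurable χ) : ReverseHolder (κ.map (Prod.map φ χ)) p q K := by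
  intro f h hf hh
  have hm := hφ.prodMap hχ
  rw [integral_map hm.aemeasurable
      ((hf.rpow p).comp measurable_fst).measurable.aestronglyMeasurable,
    integral_map hm.aemeasurable
      ((hh.rpow q).comp measurable_snd).measurable.aestronglyMeasurable,
    integral_map hm.aemeasurable
      ((hf.comp measurable_fst).mul (hh.comp measurable_snd)).measurable.aestronglyMeasurable]
  exact H _ _ (hf.comp hφ) (hh.comp hχ)

lemma ReverseHolder.of_jointLaw_map_add_right {E : Type*} [AddCommGroup E] [MeasurableSpace E]
    [MeasurableAdd₂ E] {ρ σ : Measure E} [SFinite ρ] [SFinite σ] {a b : E} {p q K : ℝ}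
    (H : ReverseHolder (jointLaw (ρ.map (· + a)) (σ.map (· + b))) p q K) :
    ReverseHolder (jointLaw ρ σ) p q K := by
  have hmap : (jointLaw (ρ.map (· + a)) (σ.map (· + b))).map
      (Prod.map (· + -(a + b)) (· + -a)) = jointLaw ρ σ := by
    rw [jointLaw, Measure.map_prod_map _ _ (by fun_prop) (by fun_prop),
      Measure.map_map (by fun_prop) (by fun_prop), Measure.map_map (by fun_prop) (by fun_prop),
      jointLaw]
    congr 1
    ext z
    · simp only [Function.comp_apply, Prod.map_fst, Prod.map_snd, neg_add_rev]
      abel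
    · simp
  exact hmap ▸ H.map (by fun_prop) (by fun_prop)

lemma IsConvolutionSemigroup.levyAct_rpow_le_of_reverseHolder {E : Type*} [NormedAddCommGroup E]
    [MeasurableSpace E] [MeasurableAdd₂ E] {μ : ℝ → Measure E} (hμ : IsConvolutionSemigroup μ)
    {s t q₁ q₂ K : ℝ} (hs : 0 ≤ s) (hst : s ≤ t) (hq₁ : 0 < q₁) (hq₂ : q₂ ∈ Ioo 0 1) (hK : 0 ≤ K)
    (H : ReverseHolder (jointLaw (μ s) (μ (t - s))) q₁ (-(q₂ / (1 - q₂))) K) {f : E → ℝ≥0∞}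
    (hf : Measurable f) (x : E) :
    levyAct μ t (fun y => f y ^ q₁) x ^ (1 / q₁) ≤
      levyAct μ s (fun y => levyAct μ (t - s) f y ^ q₂) x ^ (1 / q₂) * ENNReal.ofReal K := by
  have hts : 0 ≤ t - s := sub_nonneg.2 hst
  have := hμ.isProbabilityMeasure s hs
  have := hμ.isProbabilityMeasure (t - s) hts
  have hconv : (μ s).conv (μ (t - s)) = μ t := by rw [← hμ.add s (t - s) hs hts, add_sub_cancel]
  have := H.lintegral_rpow_le hq₁ hq₂ hK (hf.comp (measurable_const_add x))
  simpa only [levyAct, one_div, hconv, Function.comp_apply, add_assoc, mul_comm] using this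

section Generator

lemma norm_one_div_one_add_norm_sq_smul_le {E : Type*} [SeminormedAddCommGroup E] [NormedSpace ℝ E]
    (z : E) : ‖(1 / (1 + ‖z‖ ^ 2)) • z‖ ≤ 1 := by
  rw [norm_smul, Real.norm_of_nonneg (by positivity), one_div_mul_eq_div,
    div_le_one (by positivity)]
  nlinarith [norm_nonneg z]

variable {E : Type*} [NormedAddCommGroup E] [NormedSpace ℝ E]

lemma fderiv_mul_cos_of_eventuallyEq_one (L : StrongDual ℝ E) {χ : E → ℝ} (hχ : χ =ᶠ[𝓝 0] 1) :
    fderiv ℝ (fun y => χ y * Real.cos (L y)) 0 = 0 := by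
  have h : (fun y => χ y * Real.cos (L y)) =ᶠ[𝓝 0] fun y => Real.cos (L y) := by
    filter_upwards [hχ] with y hy using by simp [hy]
  rw [h.fderiv_eq, fderiv_cos (by fun_prop)]
  simp

lemma fderiv_mul_sin_of_eventuallyEq_one (L : StrongDual ℝ E) {χ : E → ℝ} (hχ : χ =ᶠ[𝓝 0] 1) :
    fderiv ℝ (fun y => χ y * Real.sin (L y)) 0 = L := by
  have h : (fun y => χ y * Real.sin (L y)) =ᶠ[𝓝 0] fun y => Real.sin (L y) := by
    filter_upwards [hχ] with y hy using by simp [hy]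
  rw [h.fderiv_eq, fderiv_sin (by fun_prop)]
  simp

variable [MeasurableSpace E]

lemma HasCharExponent.tendsto_charFunDual_sub_one_div {μ : ℝ → Measure E}
    {ψ : StrongDual ℝ E → ℂ} (hψ : HasCharExponent μ ψ) (L : StrongDual ℝ E) :
    Tendsto (fun t : ℝ => (charFunDual (μ t) L - 1) / t) (𝓝[>] 0) (𝓝 (ψ L)) := by
  have hderiv : HasDerivAt (fun t : ℝ => Complex.exp (t * ψ L)) (ψ L) 0 := by
    simpa using (((hasDerivAt_id (0 : ℝ)).ofReal_comp).mul_const (ψ L)).cexp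
  refine hderiv.tendsto_slope_zero_right.congr' ?_
  filter_upwards [self_mem_nhdsWithin] with t (ht : 0 < t)
  rw [hψ.charFunDual_eq t ht.le, zero_add, Complex.ofReal_zero, zero_mul, Complex.exp_zero,
    Complex.real_smul, Complex.ofReal_inv, div_eq_inv_mul]

variable [BorelSpace E]

/-- The integral of the compensator `z / (1 + ‖z‖ ^ 2)` against `ν`: the drift by which the
pure-jump semigroup of a finite measure `ν` differs from a compound Poisson semigroup. -/
noncomputable def levyDrift (ν : Measure E) : E := ∫ z, (1 / (1 + ‖z‖ ^ 2)) • z ∂ν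

lemma integrable_mul_exp_mul_I (κ : Measure E) [IsFiniteMeasure κ] (L : StrongDual ℝ E)
    {χ : E → ℝ} (hχ : Continuous χ) (hs : HasCompactSupport χ) :
    Integrable (fun y => χ y * Complex.exp (L y * Complex.I)) κ := by
  obtain ⟨C, hC⟩ := hs.exists_bound_of_continuous hχ
  exact .of_bound (C := C) (Measurable.aestronglyMeasurable (by fun_prop))
    (Eventually.of_forall fun v => by simpa [Complex.norm_exp_ofReal_mul_I] using hC v)

lemma integral_mul_exp_mul_I (κ : Measure E) [IsFiniteMeasure κ] (L : StrongDual ℝ E)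
    {χ : E → ℝ} (hχ : Continuous χ) (hs : HasCompactSupport χ) :
    ∫ y, χ y * Complex.exp (L y * Complex.I) ∂κ =
      (∫ y, χ y * Real.cos (L y) ∂κ : ℝ) + (∫ y, χ y * Real.sin (L y) ∂κ : ℝ) * Complex.I := by
  rw [← integral_re_add_im (integrable_mul_exp_mul_I κ L hχ hs)]
  simp [Complex.exp_ofReal_mul_I_re, Complex.exp_ofReal_mul_I_im]

lemma norm_charFunDual_sub_integral_mul_le (κ : Measure E) [IsFiniteMeasure κ]
    (L : StrongDual ℝ E) {χ : E → ℝ} (hχ : Continuous χ) (hs : HasCompactSupport χ)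
    (hχle : ∀ x, χ x ≤ 1) :
    ‖charFunDual κ L - ∫ y, χ y * Complex.exp (L y * Complex.I) ∂κ‖ ≤ ∫ y, (1 - χ y) ∂κ := by
  rw [charFunDual_apply, ← integral_sub (integrable_exp_mul_I κ L)
    (integrable_mul_exp_mul_I κ L hχ hs)]
  refine (norm_integral_le_integral_norm _).trans_eq (integral_congr_ae <| .of_forall fun y => ?_)
  simp only
  rw [← one_sub_mul, norm_mul, Complex.norm_exp_ofReal_mul_I, mul_one, ← Complex.ofReal_one,
    ← Complex.ofReal_sub, Complex.norm_real, Real.norm_of_nonneg (sub_nonneg.2 (hχle y))]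

variable [SecondCountableTopology E] [CompleteSpace E] {μ : ℝ → Measure E} {ν : Measure E}
  [IsFiniteMeasure ν]

lemma levyOperator_eq_sub_levyDrift {f : E → ℝ} {x : E} (hf : Integrable (fun z => f (x + z)) ν) :
    levyOperator ν f x =
      ∫ z, f (x + z) ∂ν - ν.real univ * f x - fderiv ℝ f x (levyDrift ν) := by
  have hdrift : Integrable (fun z : E => (1 / (1 + ‖z‖ ^ 2)) • z) ν :=
    .of_bound (C := 1) (Measurable.aestronglyMeasurable (by fun_prop))
      (Eventually.of_forall norm_one_div_one_add_norm_sq_smul_le)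
  have hcomp : ∀ z, fderiv ℝ f x z * (1 / (1 + ‖z‖ ^ 2)) =
      fderiv ℝ f x ((1 / (1 + ‖z‖ ^ 2)) • z) := fun z => by
    rw [map_smul, smul_eq_mul, mul_comm]
  simp only [levyOperator, hcomp]
  have hsub : Integrable (fun z => f (x + z) - f x) ν := hf.sub (integrable_const _)
  have hlin : Integrable (fun z => fderiv ℝ f x ((1 / (1 + ‖z‖ ^ 2)) • z)) ν :=
    (fderiv ℝ f x).integrable_comp hdrift
  rw [integral_sub hsub hlin, integral_sub hf (integrable_const _), integral_const, smul_eq_mul,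
    (fderiv ℝ f x).integral_comp_comm hdrift, levyDrift]

namespace IsPureJumpLevySemigroup

lemma tendsto_integral_mul_exp (hμ : IsPureJumpLevySemigroup ν μ) (L : StrongDual ℝ E) {χ : E → ℝ}
    (hχ : ContDiff ℝ ∞ χ) (hs : HasCompactSupport χ) (hχ1 : χ =ᶠ[𝓝 0] 1) :
    Tendsto (fun t : ℝ => (∫ y, χ y * Complex.exp (L y * Complex.I) ∂(μ t) - 1) / t) (𝓝[>] 0)
      (𝓝 (∫ z, χ z * Complex.exp (L z * Complex.I) ∂ν - ν.real univ -
        L (levyDrift ν) * Complex.I)) := by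
  have hχ0 : χ 0 = 1 := hχ1.self_of_nhds
  have hint : ∀ {g : E → ℝ}, Continuous g → Integrable (fun z => χ (0 + z) * g (0 + z)) ν :=
    fun {g} hg => by
      simp only [zero_add]
      exact (hχ.continuous.mul hg).integrable_of_hasCompactSupport hs.mul_right
  have hcos := hμ.generator (fun y => χ y * Real.cos (L y)) (by fun_prop) hs.mul_right 0
  have hsin := hμ.generator (fun y => χ y * Real.sin (L y)) (by fun_prop) hs.mul_right 0
  rw [levyOperator_eq_sub_levyDrift (hint (g := fun z => Real.cos (L z)) (by fun_prop)),
    fderiv_mul_cos_of_eventuallyEq_one L hχ1] at hcos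
  rw [levyOperator_eq_sub_levyDrift (hint (g := fun z => Real.sin (L z)) (by fun_prop)),
    fderiv_mul_sin_of_eventuallyEq_one L hχ1] at hsin
  simp only [zero_add, hχ0, map_zero, Real.cos_zero, Real.sin_zero, mul_one, mul_zero, sub_zero,
    zero_apply] at hcos hsin
  have hlim := ((Complex.continuous_ofReal.tendsto _).comp hcos).add
    (((Complex.continuous_ofReal.tendsto _).comp hsin).mul_const Complex.I)
  convert hlim.congr' ?_ using 2
  · rw [integral_mul_exp_mul_I ν L hχ.continuous hs]
    push_cast
    ring
  · filter_upwards [self_mem_nhdsWithin] with t ht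
    have := hμ.isProbabilityMeasure t (le_of_lt ht)
    rw [integral_mul_exp_mul_I (μ t) L hχ.continuous hs]
    simp only [Function.comp_apply]
    push_cast
    ring

lemma tendsto_integral_one_sub_div (hμ : IsPureJumpLevySemigroup ν μ) {χ : E → ℝ}
    (hχ : ContDiff ℝ ∞ χ) (hs : HasCompactSupport χ) (hχ1 : χ =ᶠ[𝓝 0] 1) :
    Tendsto (fun t : ℝ => (∫ y, (1 - χ y) ∂(μ t)) / t) (𝓝[>] 0) (𝓝 (∫ z, (1 - χ z) ∂ν)) := by
  have hint : ∀ (κ : Measure E) [IsFiniteMeasure κ], Integrable χ κ := fun κ _ =>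
    hχ.continuous.integrable_of_hasCompactSupport hs
  have hgen := (hμ.generator χ hχ hs 0).neg
  rw [levyOperator_eq_sub_levyDrift (by simpa only [zero_add] using hint ν), hχ1.fderiv_eq] at hgen
  simp only [zero_add, show χ 0 = 1 from hχ1.self_of_nhds, mul_one] at hgen
  convert hgen.congr' ?_ using 2
  · rw [integral_sub (integrable_const _) (hint ν)]
    simp
  · filter_upwards [self_mem_nhdsWithin] with t ht
    have := hμ.isProbabilityMeasure t (le_of_lt ht)
    rw [integral_sub (integrable_const _) (hint (μ t)), ← neg_div]
    simp

lemma norm_exponent_sub_le (hμ : IsPureJumpLevySemigroup ν μ) {ψ : StrongDual ℝ E → ℂ}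
    (hψ : HasCharExponent μ ψ) (L : StrongDual ℝ E) {χ : E → ℝ} (hχ : ContDiff ℝ ∞ χ)
    (hs : HasCompactSupport χ) (hχ1 : χ =ᶠ[𝓝 0] 1) (hχle : ∀ x, χ x ≤ 1) :
    ‖ψ L - (charFunDual ν L - ν.real univ - L (levyDrift ν) * Complex.I)‖ ≤
      2 * ∫ z, (1 - χ z) ∂ν := by
  have htail : ‖ψ L - (∫ z, χ z * Complex.exp (L z * Complex.I) ∂ν - ν.real univ -
      L (levyDrift ν) * Complex.I)‖ ≤ ∫ z, (1 - χ z) ∂ν := by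
    refine le_of_tendsto_of_tendsto
      ((hψ.tendsto_charFunDual_sub_one_div L).sub (hμ.tendsto_integral_mul_exp L hχ hs hχ1)).norm
      (hμ.tendsto_integral_one_sub_div hχ hs hχ1) ?_
    filter_upwards [self_mem_nhdsWithin] with t (ht : 0 < t)
    have := hμ.isProbabilityMeasure t ht.le
    rw [← sub_div, sub_sub_sub_cancel_right, norm_div, Complex.norm_real, Real.norm_of_nonneg ht.le]
    gcongr
    exact norm_charFunDual_sub_integral_mul_le (μ t) L hχ.continuous hs hχle
  calc ‖ψ L - (charFunDual ν L - ν.real univ - L (levyDrift ν) * Complex.I)‖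
      = ‖(ψ L - (∫ z, χ z * Complex.exp (L z * Complex.I) ∂ν - ν.real univ -
          L (levyDrift ν) * Complex.I)) -
          (charFunDual ν L - ∫ z, χ z * Complex.exp (L z * Complex.I) ∂ν)‖ := by congr 1; ring
    _ ≤ _ := norm_sub_le _ _
    _ ≤ _ := add_le_add htail (norm_charFunDual_sub_integral_mul_le ν L hχ.continuous hs hχle)
    _ = _ := by ring

end IsPureJumpLevySemigroup

end Generator

lemma IsPureJumpLevySemigroup.exponent_eq {E : Type*} [NormedAddCommGroup E] [NormedSpace ℝ E]
    [FiniteDimensional ℝ E] [MeasurableSpace E] [BorelSpace E] {μ : ℝ → Measure E} {ν : Measure E}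
    [IsFiniteMeasure ν] (hμ : IsPureJumpLevySemigroup ν μ)
    {ψ : StrongDual ℝ E → ℂ} (hψ : HasCharExponent μ ψ) (L : StrongDual ℝ E) :
    ψ L = charFunDual ν L - ν.real univ - L (levyDrift ν) * Complex.I := by
  let χ (n : ℕ) : ContDiffBump (0 : E) := ⟨n + 1, n + 2, by positivity, by linarith⟩
  have hlim : Tendsto (fun n => ∫ z, (1 - χ n z) ∂ν) atTop (𝓝 0) := by
    rw [← integral_zero E ℝ (μ := ν)]
    refine tendsto_integral_of_dominated_convergence (fun _ => 1)
      (fun n => (continuous_const.sub (χ n).continuous).aestronglyMeasurable) (integrable_const _)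
      (fun n => Eventually.of_forall fun z => ?_) (Eventually.of_forall fun z => ?_)
    · rw [Real.norm_of_nonneg (sub_nonneg.2 (χ n).le_one)]
      linarith [(χ n).nonneg (x := z)]
    · refine tendsto_const_nhds.congr' ?_
      filter_upwards [eventually_ge_atTop ⌈‖z‖⌉₊] with n hn
      rw [(χ n).one_of_mem_closedBall, sub_self]
      rw [mem_closedBall_zero_iff]
      linarith [Nat.ceil_le.1 hn, show (χ n).rIn = n + 1 from rfl]
  rw [← sub_eq_zero, ← norm_le_zero_iff]
  refine ge_of_tendsto' (by simpa using hlim.const_mul 2) fun n => ?_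
  exact hμ.norm_exponent_sub_le hψ L (χ n).contDiff (χ n).hasCompactSupport
    (χ n).eventuallyEq_one fun x => (χ n).le_one

section CompoundPoisson

variable {E : Type*}

lemma convPow_apply_univ [AddMonoid E] [MeasurableSpace E] [MeasurableAdd₂ E] (κ : Measure E)
    [IsFiniteMeasure κ] (n : ℕ) : convPow κ n univ = κ univ ^ n := by
  induction n with
  | zero => simp [convPow]
  | succ n ih =>
    rw [convPow, Measure.conv, Measure.map_apply (by fun_prop) .univ, preimage_univ,
      ← univ_prod_univ, Measure.prod_prod, ih, pow_succ]

/-- The law at time `t` of the compound Poisson process whose jumps have intensity measure `ν`. -/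
noncomputable def compoundPoisson [AddMonoid E] [MeasurableSpace E] (ν : Measure E) (t : ℝ) :
    Measure E :=
  Measure.sum fun n : ℕ =>
    ENNReal.ofReal (Real.exp (-(t * ν.real univ)) * t ^ n / n.factorial) • convPow ν n

lemma isProbabilityMeasure_compoundPoisson [AddMonoid E] [MeasurableSpace E] [MeasurableAdd₂ E]
    (ν : Measure E) [IsFiniteMeasure ν] {t : ℝ} (ht : 0 ≤ t) :
    IsProbabilityMeasure (compoundPoisson ν t) := by
  have hterm : ∀ n : ℕ,
      ENNReal.ofReal (Real.exp (-(t * ν.real univ)) * t ^ n / n.factorial) * ν univ ^ n =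
        ENNReal.ofReal (Real.exp (-(t * ν.real univ)) * (t * ν.real univ) ^ n / n.factorial) :=
    fun n => by
      rw [← ofReal_measureReal, ← ENNReal.ofReal_pow measureReal_nonneg,
        ← ENNReal.ofReal_mul (by positivity)]
      ring_nf
  have hsum : HasSum (fun n : ℕ =>
      Real.exp (-(t * ν.real univ)) * (t * ν.real univ) ^ n / n.factorial) 1 :=
    ProbabilityTheory.hasSum_one_poissonMeasure ⟨_, mul_nonneg ht measureReal_nonneg⟩
  constructor
  simp only [compoundPoisson, Measure.sum_apply _ .univ, Measure.smul_apply, convPow_apply_univ,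
    smul_eq_mul, hterm]
  rw [← ENNReal.ofReal_tsum_of_nonneg (fun n => by positivity) hsum.summable, hsum.tsum_eq,
    ENNReal.ofReal_one]

lemma compoundPoisson_real_compl_singleton_zero_le [AddMonoid E] [MeasurableSpace E]
    [MeasurableAdd₂ E] [MeasurableSingletonClass E] (ν : Measure E) [IsFiniteMeasure ν] {t : ℝ}
    (ht : 0 ≤ t) : (compoundPoisson ν t).real {0}ᶜ ≤ t * ν.real univ := by
  have := isProbabilityMeasure_compoundPoisson ν ht
  have hatom : Real.exp (-(t * ν.real univ)) ≤ (compoundPoisson ν t).real {0} := by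
    refine (ENNReal.ofReal_le_iff_le_toReal (measure_ne_top _ _)).1 ?_
    refine le_trans ?_ (Measure.le_sum _ 0 {0})
    simp [convPow]
  rw [probReal_compl_eq_one_sub (measurableSet_singleton 0)]
  linarith [Real.add_one_le_exp (-(t * ν.real univ))]

variable [NormedAddCommGroup E] [NormedSpace ℝ E] [MeasurableSpace E] [BorelSpace E]
  [SecondCountableTopology E]

lemma hasCharExponent_compoundPoisson (ν : Measure E) [IsFiniteMeasure ν] :
    HasCharExponent (compoundPoisson ν) fun L => charFunDual ν L - ν.real univ where
  isProbabilityMeasure t ht := isProbabilityMeasure_compoundPoisson ν ht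
  charFunDual_eq t ht L := by
    have := isProbabilityMeasure_compoundPoisson ν ht
    have hterm : ∀ n : ℕ, ∫ y, Complex.exp (L y * Complex.I)
        ∂(ENNReal.ofReal (Real.exp (-(t * ν.real univ)) * t ^ n / n.factorial) • convPow ν n) =
          Complex.exp (-(t * ν.real univ)) * ((t * charFunDual ν L) ^ n / n.factorial) :=
      fun n => by
        rw [integral_smul_measure, ← charFunDual_apply, charFunDual_convPow,
          ENNReal.toReal_ofReal (by positivity), Complex.real_smul]
        push_cast
        ring
    have hsum := hasSum_integral_measure (integrable_exp_mul_I (compoundPoisson ν t) L)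
    simp only [hterm] at hsum
    rw [← compoundPoisson, ← charFunDual_apply] at hsum
    rw [hsum.unique
      ((NormedSpace.expSeries_div_hasSum_exp (t * charFunDual ν L)).mul_left _),
      ← Complex.exp_eq_exp_ℂ, ← Complex.exp_add]
    ring_nf

end CompoundPoisson

lemma tendsto_exp_div_mul_add_sq_pow (c a M : ℝ) :
    Tendsto (fun n : ℕ => Real.exp (c / n * a + M * (c / n) ^ 2) ^ n) atTop
      (𝓝 (Real.exp (c * a))) := by
  have hlim : Tendsto (fun n : ℕ => c * a + M * c ^ 2 * (n : ℝ)⁻¹) atTop (𝓝 (c * a)) := by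
    simpa using ((tendsto_inv_atTop_nhds_zero_nat (𝕜 := ℝ)).const_mul (M * c ^ 2)).const_add (c * a)
  refine ((Real.continuous_exp.tendsto _).comp hlim).congr' ?_
  filter_upwards [eventually_ne_atTop 0] with n hn
  rw [← Real.exp_nat_mul, Function.comp_apply]
  congr 1
  field_simp

section SpaceTime

variable {E : Type*} [NormedAddCommGroup E] [NormedSpace ℝ E] [FiniteDimensional ℝ E]
  [MeasurableSpace E] [BorelSpace E] {μ : ℝ → Measure E}

lemma IsConvolutionSemigroup.reverseHolder_jointLaw (hμ : IsConvolutionSemigroup μ)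
    {r t α p : ℝ} (hr : r ∈ Ioc 0 1) (ht : 0 ≤ t) (hα : 0 < α) (hp : p⁻¹ = 1 + α⁻¹) :
    ReverseHolder (jointLaw (μ (r * t)) (μ ((1 - r) * t))) p (-(r * α)) 1 := by
  obtain ⟨ψ, hψ⟩ := hμ.exists_hasCharExponent
  have hp0 : p ≠ 0 := inv_eq_zero.not.1 (hp ▸ by positivity)
  refine hψ.reverseHolder_jointLaw (Ioc_subset_Icc_self hr) ht hp0
    (neg_ne_zero.2 (mul_pos hr.1 hα).ne') (k := fun _ => 1) (fun _ => zero_le_one) (by simp)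
    (Eventually.of_forall fun n => ?_)
  have := hμ.isProbabilityMeasure (t / n) (by positivity)
  exact .thinnedPair_one _ hr hα hp

variable {ν : Measure E} [IsFiniteMeasure ν]

namespace IsPureJumpLevySemigroup

lemma map_add_levyDrift_eq_compoundPoisson (hμ : IsPureJumpLevySemigroup ν μ) {t : ℝ}
    (ht : 0 ≤ t) : (μ t).map (· + t • levyDrift ν) = compoundPoisson ν t := by
  obtain ⟨ψ, hψ⟩ := hμ.exists_hasCharExponent
  have hshift := hψ.map_add_smul (levyDrift ν)
  simp only [hμ.exponent_eq hψ, sub_add_cancel] at hshift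
  exact hshift.unique (hasCharExponent_compoundPoisson ν) ht

lemma real_map_add_levyDrift_compl_singleton_zero_le (hμ : IsPureJumpLevySemigroup ν μ) {t : ℝ}
    (ht : 0 ≤ t) : ((μ t).map (· + t • levyDrift ν)).real {0}ᶜ ≤ t * ν.real univ := by
  rw [hμ.map_add_levyDrift_eq_compoundPoisson ht]
  exact compoundPoisson_real_compl_singleton_zero_le ν ht

lemma reverseHolder_jointLaw_of_lt (hμ : IsPureJumpLevySemigroup ν μ) {r t α β p : ℝ}
    (hβ : 0 < β) (hβα : β < α) (hr : 1 + β = r * (1 + α)) (ht : 0 ≤ t) (hp : p⁻¹ = 1 + α⁻¹) :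
    ReverseHolder (jointLaw (μ (r * t)) (μ ((1 - r) * t))) p (-β)
      (Real.exp (t * ν.real univ * (r / β - α⁻¹))) := by
  have hα : 0 < α := hβ.trans hβα
  have hr01 : r ∈ Icc 0 1 := ⟨by nlinarith, by nlinarith⟩
  have hp0 : p ≠ 0 := inv_eq_zero.not.1 (hp ▸ by positivity)
  obtain ⟨ψ, hψ⟩ := hμ.exists_hasCharExponent
  have hshift := hψ.map_add_smul (levyDrift ν)
  have := hμ.isProbabilityMeasure _ (mul_nonneg hr01.1 ht)
  have := hμ.isProbabilityMeasure _ (mul_nonneg (sub_nonneg.2 hr01.2) ht)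
  refine (hshift.reverseHolder_jointLaw hr01 ht hp0 (neg_ne_zero.2 hβ.ne')
    (fun n => (Real.exp_pos _).le) (tendsto_exp_div_mul_add_sq_pow (t * ν.real univ)
      (r / β - α⁻¹) (2 * (r + β / α * (1 - r) ^ (-α)) ^ 2 / β)) ?_).of_jointLaw_map_add_right
  have hsmall : Tendsto (fun n : ℕ => (r + β / α * (1 - r) ^ (-α)) * (t * ν.real univ / n)) atTop
      (𝓝 0) := by
    simpa using (tendsto_const_div_atTop_nhds_zero_nat (t * ν.real univ)).const_mul
      (r + β / α * (1 - r) ^ (-α))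
  filter_upwards [hsmall.eventually_le_const one_half_pos] with n hn
  have htn : 0 ≤ t / n := by positivity
  have := hshift.isProbabilityMeasure _ htn
  convert ReverseHolder.thinnedPair_exp _ hβ hβα hr hp
    ((hμ.real_map_add_levyDrift_compl_singleton_zero_le htn).trans_eq
      (div_mul_eq_mul_div _ _ _)) hn using 2
  ring

lemma reverseHolder_jointLaw (hμ : IsPureJumpLevySemigroup ν μ) {r t α β p : ℝ}
    (hβ : 0 < β) (hβα : β ≤ α) (hr : 1 + β = r * (1 + α)) (ht : 0 ≤ t) (hp : p⁻¹ = 1 + α⁻¹) :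
    ReverseHolder (jointLaw (μ (r * t)) (μ ((1 - r) * t))) p (-β)
      (Real.exp (t * ν.real univ * (r / β - α⁻¹))) := by
  rcases hβα.lt_or_eq with hlt | rfl
  · exact hμ.reverseHolder_jointLaw_of_lt hβ hlt hr ht hp
  · obtain rfl : r = 1 := mul_right_cancel₀ (by positivity) (hr.symm.trans (one_mul _).symm)
    simpa [one_div] using
      hμ.toIsConvolutionSemigroup.reverseHolder_jointLaw (right_mem_Ioc.2 one_pos) ht hβ hp

end IsPureJumpLevySemigroup

theorem IsConvolutionSemigroup.levyAct_rpow_le_levyAct_rpow (hμ : IsConvolutionSemigroup μ)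
    {s t q₁ q₂ : ℝ} (hs : 0 < s) (hst : s ≤ t) (hq₂ : 0 < q₂) (hq : q₂ ≤ q₁) (hq₁ : q₁ < 1)
    (hrel : q₂ - 1 = q₂ / q₁ * (t / s) * (q₁ - 1)) {f : E → ℝ≥0∞} (hf : Measurable f) (x : E) :
    levyAct μ t (fun y => f y ^ q₁) x ^ (1 / q₁) ≤
      levyAct μ s (fun y => levyAct μ (t - s) f y ^ q₂) x ^ (1 / q₂) := by
  have ht : 0 < t := hs.trans_le hst
  have hq₁0 : 0 < q₁ := hq₂.trans_le hq
  have h1 : 0 < 1 - q₁ := sub_pos.2 hq₁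
  have hβ : q₂ / (1 - q₂) = s / t * (q₁ / (1 - q₁)) := by
    rw [show 1 - q₂ = q₂ / q₁ * (t / s) * (1 - q₁) by linarith]
    field_simp
  have H := hμ.reverseHolder_jointLaw ⟨div_pos hs ht, (div_le_one ht).2 hst⟩ ht.le
    (div_pos hq₁0 h1) (p := q₁) (by field_simp; ring)
  rw [div_mul_cancel₀ s ht.ne', one_sub_mul, div_mul_cancel₀ s ht.ne', ← hβ] at H
  simpa using hμ.levyAct_rpow_le_of_reverseHolder hs.le hst hq₁0 ⟨hq₂, hq.trans_lt hq₁⟩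
    zero_le_one H hf x

theorem IsPureJumpLevySemigroup.levyAct_rpow_le_levyAct_rpow_mul_exp
    (hμ : IsPureJumpLevySemigroup ν μ) {s t q₁ q₂ : ℝ} (hs : 0 < s) (hst : s ≤ t) (hq₂ : 0 < q₂)
    (hq : q₂ ≤ q₁) (hq₁ : q₁ < 1) (hrel : q₂ - 1 = t / s * (q₁ - 1)) {f : E → ℝ≥0∞}
    (hf : Measurable f) (x : E) :
    levyAct μ t (fun y => f y ^ q₁) x ^ (1 / q₁) ≤
      levyAct μ s (fun y => levyAct μ (t - s) f y ^ q₂) x ^ (1 / q₂) * ENNReal.ofReal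
        (Real.exp (ν.real univ * (s * (t - s) * (1 - q₂) ^ 2 / (q₂ * (s * q₂ + t - s))))) := by
  have ht : 0 < t := hs.trans_le hst
  have hq₁0 : 0 < q₁ := hq₂.trans_le hq
  have : 0 < 1 - q₁ := sub_pos.2 hq₁
  have h2 : 0 < 1 - q₂ := sub_pos.2 (hq.trans_lt hq₁)
  have hd : 0 < s * q₂ + t - s := by linarith [mul_pos hs hq₂]
  have hq₁t : q₁ = (s * q₂ + t - s) / t := by
    field_simp at hrel ⊢
    linarith
  have h1t : 1 - q₁ = s * (1 - q₂) / t := by rw [hq₁t]; field_simp; ring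
  have H := hμ.reverseHolder_jointLaw (r := s / t) (α := q₁ / (1 - q₁)) (β := q₂ / (1 - q₂))
    (p := q₁) (div_pos hq₂ h2) (by gcongr) (by rw [h1t, hq₁t]; field_simp; ring) ht.le
    (by field_simp; ring)
  have hconst : t * ν.real univ * (s / t / (q₂ / (1 - q₂)) - (q₁ / (1 - q₁))⁻¹) =
      ν.real univ * (s * (t - s) * (1 - q₂) ^ 2 / (q₂ * (s * q₂ + t - s))) := by
    rw [h1t, hq₁t]
    field_simp
    ring
  rw [div_mul_cancel₀ s ht.ne', one_sub_mul, div_mul_cancel₀ s ht.ne', hconst] at H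
  exact hμ.levyAct_rpow_le_of_reverseHolder hs.le hst hq₁0 ⟨hq₂, hq.trans_lt hq₁⟩
    (Real.exp_pos _).le H hf x

end SpaceTime

theorem mainTheorem7_general {E : Type*} [NormedAddCommGroup E] [NormedSpace ℝ E]
    [FiniteDimensional ℝ E] [MeasurableSpace E] [BorelSpace E]
    (μ : ℝ → Measure E) (hμ : IsConvolutionSemigroup μ) :
    (∀ s t q₁ q₂ : ℝ, 0 < s → s ≤ t → 0 < q₂ → q₂ ≤ q₁ → q₁ < 1 →
      q₂ - 1 = q₂ / q₁ * (t / s) * (q₁ - 1) →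
      ∀ f : E → ℝ≥0∞, Measurable f → ∀ x : E,
        levyAct μ t (fun y => f y ^ q₁) x ^ (1 / q₁) ≤
          levyAct μ s (fun y => levyAct μ (t - s) f y ^ q₂) x ^ (1 / q₂)) ∧
    (∀ ν : Measure E, IsPureJumpLevySemigroup ν μ → ν univ < ⊤ →
      ∀ s t q₁ q₂ : ℝ, 0 < s → s ≤ t → 0 < q₂ → q₂ ≤ q₁ → q₁ < 1 →
      q₂ - 1 = t / s * (q₁ - 1) →
      ∀ f : E → ℝ≥0∞, Measurable f → ∀ x : E,
        levyAct μ t (fun y => f y ^ q₁) x ^ (1 / q₁) ≤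
          levyAct μ s (fun y => levyAct μ (t - s) f y ^ q₂) x ^ (1 / q₂) *
            ENNReal.ofReal (Real.exp
              (ν.real univ * (s * (t - s) * (1 - q₂) ^ 2 / (q₂ * (s * q₂ + t - s)))))) := by
  constructor
  · intro s t q₁ q₂ hs hst hq₂ hq hq₁ hrel f hf x
    exact hμ.levyAct_rpow_le_levyAct_rpow hs hst hq₂ hq hq₁ hrel hf x
  · intro ν hν hfin s t q₁ q₂ hs hst hq₂ hq hq₁ hrel f hf x
    have : IsFiniteMeasure ν := ⟨hfin⟩
    exact hν.levyAct_rpow_le_levyAct_rpow_mul_exp hs hst hq₂ hq hq₁ hrel hf x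

theorem mainTheorem7 {E : Type*} [NormedAddCommGroup E] [InnerProductSpace ℝ E]
    [FiniteDimensional ℝ E] [MeasurableSpace E] [BorelSpace E]
    (ν : Measure E) (hν : IsLevyMeasure ν)
    (μ : ℝ → Measure E) (hμ : IsPureJumpLevySemigroup ν μ) :
    (∀ s t q₁ q₂ : ℝ, 0 < s → s ≤ t → 0 < q₂ → q₂ ≤ q₁ → q₁ < 1 →
      q₂ - 1 = q₂ / q₁ * (t / s) * (q₁ - 1) →
      ∀ f : E → ℝ≥0∞, Measurable f → ∀ x : E,
        levyAct μ t (fun y => f y ^ q₁) x ^ (1 / q₁) ≤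
          levyAct μ s (fun y => levyAct μ (t - s) f y ^ q₂) x ^ (1 / q₂)) ∧
    (ν univ < ⊤ →
      ∀ s t q₁ q₂ : ℝ, 0 < s → s ≤ t → 0 < q₂ → q₂ ≤ q₁ → q₁ < 1 →
      q₂ - 1 = t / s * (q₁ - 1) →
      ∀ f : E → ℝ≥0∞, Measurable f → ∀ x : E,
        levyAct μ t (fun y => f y ^ q₁) x ^ (1 / q₁) ≤
          levyAct μ s (fun y => levyAct μ (t - s) f y ^ q₂) x ^ (1 / q₂) *
            ENNReal.ofReal (Real.exp
              (ν.real univ * (s * (t - s) * (1 - q₂) ^ 2 / (q₂ * (s * q₂ + t - s)))))) :=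
  (mainTheorem7_general μ hμ.toIsConvolutionSemigroup).imp_right fun h => h ν hμ
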